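/- **Setting.** Let $\mathcal X$ be a measurable space, $\mathcal Y=\{-1,+1\}$, $k\ge 1$, and let $D_1,\dots,D_k$ be probability distributions on $\mathcal X\times\mathcal Y$. Let $\mathcal H$ be a class of measurable classifiers $\mathcal X\to\mathcal Y$ of finite VC dimension $d$. Write $L_i(h)=\Pr_{D_i}[h(x)\ne y]$, $L(h)=\max_i L_i(h)$, $\rho_i(h,h')=\Pr_{D_i}[h(x)\neq h'(x)]$, $\rho=\max_i\rho_i$. For a set $V$ of classifiers let $\mathrm{DIS}(V)=\{x:\exists h,h'\in V,\ h(x)\ne h'(x)\}$. Let $h^*\in\mathcal H$ minimize $L$ over $\mathcal H$, let $\nu=L(h^*)$, and let $$\theta_{\max}(r_0)=\max_{i\le k}\ \sup_{r\ge r_0}\frac{\Pr_{D_i}\big[x\in \mathrm{DIS}(\{h\in\mathcal H:\rho_i(h,h^*)\le r\})\big]}{r}.$$ For each $i$ the learner can draw unlabelled points $x\sim D_i$ and can query the label $y\sim D_i(\cdot\mid x)$ of a drawn point. **Passive-MDL$(V,(\mu_i)_{i\le k},\zeta,\delta)$** (collaborative learner of Blum et al.). Let $R>0$, $b>1$, $\tau\in(0,1)$,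 $c>0$ be absolute constants, $t=\lceil R\log_2(2k)\rceil$, $\delta'=\delta/(4t)$. Start with weights $\alpha_i=1$. In each of $t$ rounds: draw $\lceil c\,(d\ln\frac2\zeta+\ln\frac1{\delta'})/\zeta\rceil$ examples from the mixture $\sum_i\alpha_i\mu_i/\sum_i\alpha_i$ and let $f\in V$ be an empirical risk minimizer over $V$; then, for each $i$, draw $\lceil c\ln(2k/\delta')/\zeta\rceil$ fresh examples from $\mu_i$, and if the empirical error of $f$ on them exceeds $\tau\zeta$, replace $\alpha_i$ by $b\,\alpha_i$. Output the majority vote of the $t$ minimizers. **Algorithm 1.** Input $\varepsilon,\delta$. Put $V_0=\mathcal H$, $n_0=\lceil\log_2\frac4\varepsilon\rceil$, $\varepsilon_n=2^{-n}$, $\delta_n=\frac{\delta}{2n^2}$. For $n=1,\dots,n_0$: let $D_{i,n}$ be the law of the example obtained by drawing $x\sim D_i$, querying its label if $x\in\mathrm{DIS}(V_{n-1})$, and otherwise labelling it by the unanimous prediction of $V_{n-1}$ at $x$; let $h_n$ be the output of Passive-MDL$(V_{n-1},(D_{i,n})_i,\varepsilon_n,\delta_n)$; put $V_n=\{h\in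 V_{n-1}:\rho(h,h_n)\le 2\varepsilon_n\}$. Return an arbitrary $\hat h\in V_{n_0}$. **Theorem.** There are absolute constants $R>0$, $b>1$, $\tau\in(0,1)$, $c>0$ of Passive-MDL and an absolute constant $C>0$ such that the following holds for all data as above, all $\varepsilon,\delta\in(0,1)$ with $\varepsilon\ge100\nu$, and every (measurable) rule for choosing the empirical risk minimizers. With probability at least $1-\delta$, $V_{n_0}$ is nonempty, every possible output $\hat h\in V_{n_0}$ of Algorithm 1 satisfies $$L(\hat h)\le\nu+\varepsilon,$$ and the total number of label queries of Algorithm 1 is at most $$C\,\big((d+k)\,\theta_{\max}(\varepsilon)+1\big)\,\ln\frac{2}{\varepsilon}\,\cdot\,\ln^2\frac{4(d+k)}{\varepsilon\delta}.$$ (That is, $O\big((d+k)\theta_{\max}(\varepsilon)\ln\frac1\varepsilon\big)$ up to the suppressed logarithmic factors in $k,d,1/\varepsilon,1/\delta$.) -/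

import Mathlib

open MeasureTheory Set

namespace ActiveMDL

noncomputable section

open scoped Classical

/-! ### Learning-theoretic notions

Labels are Booleans, `true` for `+1` and `false` for `-1`. -/

/-- Classifiers on the feature space `X`. -/
abbrev Classifier (X : Type*) := X → Bool

/-- Labelled examples. -/
abbrev LExample (X : Type*) := X × Bool

section Notions

variable {X : Type*} [MeasurableSpace X] {k : ℕ}

/-- The 0-1 error `L(h, D)`. -/
def err (D : Measure (LExample X)) (h : Classifier X) : ℝ :=
  D.real {z | h z.1 ≠ z.2}

/-- The multi-distribution error `L(h) = max_i L(h, D_i)`. -/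
def mdErr (D : Fin k → Measure (LExample X)) (h : Classifier X) : ℝ :=
  ⨆ i, err (D i) h

/-- The disagreement metric of one distribution. -/
def rho (D : Measure (LExample X)) (h h' : Classifier X) : ℝ :=
  D.real {z | h z.1 ≠ h' z.1}

/-- The disagreement metric `ρ = max_i ρ_i` of the instance. -/
def mdRho (D : Fin k → Measure (LExample X)) (h h' : Classifier X) : ℝ :=
  ⨆ i, rho (D i) h h'

/-- The disagreement region of a set of classifiers. -/
def DIS {X : Type*} (V : Set (Classifier X)) : Set X :=
  {x | ∃ h₁ ∈ V, ∃ h₂ ∈ V, h₁ x ≠ h₂ x}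

/-- The disagreement ball around `h`. -/
def disBall (D : Measure (LExample X)) (H : Set (Classifier X)) (h : Classifier X) (r : ℝ) :
    Set (Classifier X) :=
  {h' | h' ∈ H ∧ rho D h h' ≤ r}

/-- The disagreement coefficient: the supremum over `r ≥ r₀` of the probability of the
disagreement region of the ball of radius `r`, divided by `r` (for `r₀ > 0` the family is bounded
by `1 / r₀`). -/
def disCoeff (D : Measure (LExample X)) (H : Set (Classifier X)) (h : Classifier X) (r₀ : ℝ) : ℝ :=
  ⨆ r : Ici r₀, D.real {z | z.1 ∈ DIS (disBall D H h r)} / (r : ℝ)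

/-- The largest disagreement coefficient among the `k` distributions. -/
def disCoeffMax (D : Fin k → Measure (LExample X)) (H : Set (Classifier X)) (h : Classifier X)
    (r₀ : ℝ) : ℝ :=
  ⨆ i, disCoeff (D i) H h r₀

/-- `H` realizes every labelling of the finite set `S`. -/
def Shatters {X : Type*} (H : Set (Classifier X)) (S : Finset X) : Prop :=
  ∀ g : X → Bool, ∃ h ∈ H, ∀ x ∈ S, h x = g x

/-- The Vapnik-Chervonenkis dimension. -/
def vcDim {X : Type*} (H : Set (Classifier X)) : ℕ∞ :=
  ⨆ (S : Finset X) (_ : Shatters H S), (S.card : ℕ∞)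

end Notions

/-! ### Empirical risk minimization -/

/-- The empirical error on a finite sample. -/
def empErr {X : Type*} {m : ℕ} (S : Fin m → LExample X) (h : Classifier X) : ℝ :=
  ((Finset.univ.filter fun j => h (S j).1 ≠ (S j).2).card : ℝ) / m

/-- A learning rule: from a class and a finite sample it selects a classifier. -/
abbrev Rule (X : Type*) := Set (Classifier X) → (m : ℕ) → (Fin m → LExample X) → Classifier X

/-- The rule selects, from every nonempty class, a member of least empirical error (ties are
broken by the rule). -/
def IsERM {X : Type*} (erm : Rule X) : Prop :=
  ∀ V : Set (Classifier X), V.Nonempty → ∀ (m : ℕ) (S : Fin m → LExample X),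
    erm V m S ∈ V ∧ ∀ h ∈ V, empErr S (erm V m S) ≤ empErr S h

/-! ### Oracle calls

The randomness of the algorithm is an array of independent slots. A slot contains a uniform
variable `u`, used to choose the component of a mixture, and, for each `i`, two fresh examples
drawn from `D i`. Of `mix` only the coordinate of the chosen component is ever looked at, and the
label of an example is looked at only when its point lies in the current disagreement region:
reading it is the label query. -/

/-- One slot. -/
abbrev Slot (X : Type*) (k : ℕ) := unitInterval × (Fin k → LExample X) × (Fin k → LExample X)

namespace Slot

variable {X : Type*} {k : ℕ}

/-- The uniform variable of a slot. -/
def u (s : Slot X k) : ℝ := s.1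

/-- The candidate examples for a draw from a mixture. -/
def mix (s : Slot X k) : Fin k → LExample X := s.2.1

/-- The examples for testing. -/
def test (s : Slot X k) : Fin k → LExample X := s.2.2

end Slot

/-- All random draws of a run, indexed by phase, round and number. -/
abbrev Draws (X : Type*) (k : ℕ) := ℕ × ℕ × ℕ → Slot X k

/-- The law of the draws: all slots are independent, and so are the components of each slot. -/
def drawLaw {X : Type*} [MeasurableSpace X] {k : ℕ} (D : Fin k → Measure (LExample X)) :
    Measure (Draws X k) :=
  Measure.infinitePi fun _ => (volume : Measure unitInterval).prod
    ((Measure.pi D).prod (Measure.pi D))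

/-- The example that the learner works with when its version space is `V`: on the disagreement
region the label is queried, elsewhere it is the unanimous prediction of `V`. -/
def impute {X : Type*} (V : Set (Classifier X)) (z : LExample X) : LExample X :=
  (z.1, if z.1 ∈ DIS V then z.2 else decide (∃ h ∈ V, h z.1 = true))

/-- The component chosen by the uniform variable `u` (inversion of the distribution function):
for `u` uniform on `[0, 1]` and positive weights, `i` has probability `α i / ∑ j, α j`. -/
def mixIndex {k : ℕ} [NeZero k] (α : Fin k → ℝ) (u : ℝ) : Fin k :=
  Fin.ofNat k
    (Finset.univ.filter fun i : Fin k => ∑ j ∈ Finset.Iic i, α j < u * ∑ j, α j).card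

/-! ### The passive collaborative learner

Weights on the `k` distributions are kept, all `1` at the start. In each round an empirical risk
minimizer is computed from a sample of the weighted mixture, it is tested on fresh samples of
every distribution, and the weights of the distributions on which it fails are multiplied
by a constant factor. The output is the majority vote of the minimizers of all rounds. -/

/-- The absolute constants of the passive learner. -/
structure PassiveConstants where
  /-- constant in the number of rounds -/
  rounds : ℝ
  /-- factor for the weights of the distributions on which a test fails -/
  boost : ℝ
  /-- tests accept up to empirical error `tol * ζ` -/
  tol : ℝ
  /-- constant in the sample sizes -/
  size : ℝ
  rounds_pos : 0 < rounds
  one_lt_boost : 1 < boost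
  tol_pos : 0 < tol
  tol_lt_one : tol < 1
  size_pos : 0 < size

/-- The number of rounds, of order `log (2 k)`. -/
def numRounds (κ : PassiveConstants) (k : ℕ) : ℕ := ⌈κ.rounds * Real.logb 2 (2 * k)⌉₊

/-- The confidence parameter of a round. -/
def roundConf (κ : PassiveConstants) (k : ℕ) (δ : ℝ) : ℝ := δ / (4 * numRounds κ k)

/-- The size of the mixture sample of a round. -/
def mixSize (κ : PassiveConstants) (k d : ℕ) (ζ δ : ℝ) : ℕ :=
  ⌈κ.size * (d * Real.log (2 / ζ) + Real.log (1 / roundConf κ k δ)) / ζ⌉₊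

/-- The size of the test sample from each distribution in a round. -/
def testSize (κ : PassiveConstants) (k : ℕ) (ζ δ : ℝ) : ℕ :=
  ⌈κ.size * Real.log (2 * k / roundConf κ k δ) / ζ⌉₊

section Passive

variable {X : Type*} {k : ℕ} [NeZero k]

/-- The minimizer learned in a round, where `α` are the weights in that round and `s` are its
slots; `V` is the version space, `ζ` the target error, `δ` the failure probability. -/
def learn (κ : PassiveConstants) (erm : Rule X) (d : ℕ) (V : Set (Classifier X)) (ζ δ : ℝ)
    (α : Fin k → ℝ) (s : ℕ → Slot X k) : Classifier X :=
  erm V (mixSize κ k d ζ δ) fun j => impute V ((s j).mix (mixIndex α (s j).u))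

/-- The test of `f` on distribution `i`. -/
def accepts (κ : PassiveConstants) (V : Set (Classifier X)) (ζ δ : ℝ) (f : Classifier X)
    (s : ℕ → Slot X k) (i : Fin k) : Prop :=
  empErr (fun j : Fin (testSize κ k ζ δ) => impute V ((s j).test i)) f ≤ κ.tol * ζ

/-- The weights at the start of each round; `s r` are the slots of round `r`. -/
def weights (κ : PassiveConstants) (erm : Rule X) (d : ℕ) (V : Set (Classifier X)) (ζ δ : ℝ)
    (s : ℕ → ℕ → Slot X k) : ℕ → Fin k → ℝ
  | 0 => fun _ => 1
  | r + 1 => fun i =>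
      let α := weights κ erm d V ζ δ s r
      if accepts κ V ζ δ (learn κ erm d V ζ δ α (s r)) (s r) i then α i else κ.boost * α i

/-- The minimizer learned in round `r`. -/
def roundClassifier (κ : PassiveConstants) (erm : Rule X) (d : ℕ) (V : Set (Classifier X))
    (ζ δ : ℝ) (s : ℕ → ℕ → Slot X k) (r : ℕ) : Classifier X :=
  learn κ erm d V ζ δ (weights κ erm d V ζ δ s r) (s r)

/-- The output of the passive learner: the majority vote over all rounds. -/
def passiveMDL (κ : PassiveConstants) (erm : Rule X) (d : ℕ) (V : Set (Classifier X)) (ζ δ : ℝ)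
    (s : ℕ → ℕ → Slot X k) : Classifier X := fun x =>
  decide (numRounds κ k < 2 * ((Finset.range (numRounds κ k)).filter fun r =>
    roundClassifier κ erm d V ζ δ s r x = true).card)

/-- The number of label queries that the passive learner makes. -/
def passiveQueries (κ : PassiveConstants) (erm : Rule X) (d : ℕ) (V : Set (Classifier X))
    (ζ δ : ℝ) (s : ℕ → ℕ → Slot X k) : ℕ :=
  ∑ r ∈ Finset.range (numRounds κ k),
    (((Finset.range (mixSize κ k d ζ δ)).filter fun j =>
        ((s r j).mix (mixIndex (weights κ erm d V ζ δ s r) (s r j).u)).1 ∈ DIS V).card +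
      ∑ i : Fin k, ((Finset.range (testSize κ k ζ δ)).filter fun j =>
        ((s r j).test i).1 ∈ DIS V).card)

end Passive

/-! ### Phased disagreement-based active multi-distribution learning -/

/-- The target error of phase `n`. -/
def phaseErr (n : ℕ) : ℝ := 2⁻¹ ^ n

/-- The failure probability of phase `n ≥ 1`. -/
def phaseConf (δ : ℝ) (n : ℕ) : ℝ := δ / (2 * (n : ℝ) ^ 2)

/-- The number of phases: the least `n` with `4 * 2⁻¹ ^ n ≤ ε`, for `0 < ε ≤ 4`. -/
def numPhases (ε : ℝ) : ℕ := ⌈Real.logb 2 (4 / ε)⌉₊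

section Active

variable {X : Type*} [MeasurableSpace X] {k : ℕ} [NeZero k]

/-- The slots used in phase `n`. -/
def phaseDraws {X : Type*} {k : ℕ} (ω : Draws X k) (n : ℕ) : ℕ → ℕ → Slot X k :=
  fun r j => ω (n, r, j)

/-- The version spaces: `V_0 = H`, and `V_{n+1}` consists of the `h` in `V_n` within `ρ`-distance
`2 ε_{n+1}` of the output of the passive learner in phase `n + 1`. -/
def versionSpace (κ : PassiveConstants) (erm : Rule X) (D : Fin k → Measure (LExample X))
    (H : Set (Classifier X)) (d : ℕ) (δ : ℝ) (ω : Draws X k) : ℕ → Set (Classifier X)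
  | 0 => H
  | n + 1 =>
      let V := versionSpace κ erm D H d δ ω n
      {h | h ∈ V ∧ mdRho D h (passiveMDL κ erm d V (phaseErr (n + 1)) (phaseConf δ (n + 1))
        (phaseDraws ω (n + 1))) ≤ 2 * phaseErr (n + 1)}

/-- The total number of label queries in all phases. -/
def labelQueries (κ : PassiveConstants) (erm : Rule X) (D : Fin k → Measure (LExample X))
    (H : Set (Classifier X)) (d : ℕ) (ε δ : ℝ) (ω : Draws X k) : ℕ :=
  ∑ n ∈ Finset.range (numPhases ε),
    passiveQueries κ erm d (versionSpace κ erm D H d δ ω n) (phaseErr (n + 1))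
      (phaseConf δ (n + 1)) (phaseDraws ω (n + 1))

/-- Measurability of the execution: the classifiers computed in the run and the predictions of its
version spaces depend jointly measurably on the random draws and on the point. (Automatic, for
example, if `X` is countable and discrete.) -/
structure MeasurableRun (κ : PassiveConstants) (erm : Rule X) (D : Fin k → Measure (LExample X))
    (H : Set (Classifier X)) (d : ℕ) (ε δ : ℝ) : Prop where
  classifiers : ∀ n < numPhases ε, ∀ r < numRounds κ k,
    Measurable fun p : Draws X k × X =>
      roundClassifier κ erm d (versionSpace κ erm D H d δ p.1 n) (phaseErr (n + 1))
        (phaseConf δ (n + 1)) (phaseDraws p.1 (n + 1)) r p.2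
  predictions : ∀ n < numPhases ε, ∀ b : Bool,
    MeasurableSet {p : Draws X k × X | ∃ h ∈ versionSpace κ erm D H d δ p.1 n, h p.2 = b}

end Active

end

end ActiveMDL

/-!
The analysis follows one round of one phase of the algorithm and then adds up.

In phase `n + 1`, with target error `ζ = ε_{n+1}`, the hypothesis `100 ν ≤ ε` gives `ν ≤ 0.08 ζ`. As
long as the optimum `h*` belongs to the version space `V`, replacing labels by unanimous predictions
cannot hurt it, so that it still has error at most `0.08 ζ` for the imputed distributions. If the
empirical errors are close to the expected ones, the minimizer of a round has error at most `0.1 ζ`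
for the weighted mixture. Hence at most one sixth of the total weight lies on distributions with
error above `0.6 ζ`, and only these can fail the test. As failures double the weight of a
distribution, each distribution fails in at most a quarter of the rounds (`card_failures_le`); in
all others the minimizer has error at most `0.64 ζ` on it, and the majority vote has error at most
`3 * 0.64 ζ` (`imputedErr_majority_le`). So the output `h_n` is at distance at most
`0.08 ζ + 1.92 ζ = 2 ζ` from `h*`, which therefore stays in the version space
(`rho_passiveMDL_le`, `mem_versionSpace`). Conversely, a version space that contains `h*` has radius
at most `4 ε_n` around `h*`. For the last phase this gives the error bound, and for the others it
bounds the probability of the disagreement region by `4 θ ε_n`; with sample sizes of order `1 / ζ`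
the expected number of queries of a round does not depend on `ζ`, up to logarithms
(`labelQueries_le`).

The probabilistic part bounds the bad events of a round. They are measurable by `MeasurableRun`, so
by Fubini's theorem it suffices to bound them when all draws outside the round are fixed
(`measure_le_of_resample`). Those about fixed classifiers follow from exponential moments. The one
about the minimizer (`drawLaw_badMinimizer_le`) is the uniform convergence theorem. The class is
arbitrary, so suprema over it need not be measurable; symmetrization is therefore carried out for
the learned classifier itself, which is jointly measurable, and the class enters only through the
number of labellings of a fixed double sample (`measure_pi_learned_le`), which the Sauer-Shelah
lemma bounds.
-/

open MeasureTheory Set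

namespace ActiveMDL

open scoped Classical

/-! ### Exponential tail bounds for independent draws -/

section Tail

variable {Ω : Type*}

/-- The exponential Markov inequality for a sum of independent copies of `g`. -/
lemma measure_pi_sum_ge_le [MeasurableSpace Ω] (μ : Measure Ω) [IsProbabilityMeasure μ] {g : Ω → ℝ}
    (hg : Integrable (fun w => Real.exp (g w)) μ) {B : ℝ} (hB : ∫ w, Real.exp (g w) ∂μ ≤ Real.exp B)
    (m : ℕ) (y : ℝ) :
    Measure.pi (fun _ : Fin m => μ) {s | y ≤ ∑ j, g (s j)} ≤
      ENNReal.ofReal (Real.exp (m * B - y)) := by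
  set Q := Measure.pi (fun _ : Fin m => μ)
  have hint : Integrable (fun s : Fin m → Ω => ∏ j, Real.exp (g (s j))) Q :=
    Integrable.fintype_prod (fun _ => hg)
  have hM := mul_meas_ge_le_integral_of_nonneg (μ := Q)
    (f := fun s : Fin m → Ω => ∏ j, Real.exp (g (s j)))
    (Filter.Eventually.of_forall fun s => Finset.prod_nonneg fun j _ => (Real.exp_pos _).le)
    hint (Real.exp y)
  have hset : {s : Fin m → Ω | y ≤ ∑ j, g (s j)}
      = {s | Real.exp y ≤ ∏ j, Real.exp (g (s j))} := by
    ext s; simp [← Real.exp_sum]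
  have hpow : ∫ s, ∏ j, Real.exp (g (s j)) ∂Q = (∫ w, Real.exp (g w) ∂μ) ^ m := by
    simpa using integral_fintype_prod_eq_pow (ι := Fin m) (μ := μ) (fun w => Real.exp (g w))
  have h0 : 0 ≤ ∫ w, Real.exp (g w) ∂μ := integral_nonneg fun w => (Real.exp_pos _).le
  have hle : Q.real {s | y ≤ ∑ j, g (s j)} ≤ Real.exp (m * B - y) := by
    rw [hset, Real.exp_sub, le_div_iff₀ (Real.exp_pos _), mul_comm]
    refine hM.trans ?_
    rw [hpow, Real.exp_nat_mul]
    exact pow_le_pow_left₀ h0 hB m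
  rw [← ofReal_measureReal]
  exact ENNReal.ofReal_le_ofReal hle

/-- `e ^ a ≤ 1 + a + a ^ 2` near zero. -/
lemma exp_le_one_add_add_sq {a : ℝ} (ha : |a| ≤ 1) : Real.exp a ≤ 1 + a + a ^ 2 := by
  have := (abs_le.1 (Real.abs_exp_sub_one_sub_id_le ha)).2
  linarith

lemma exp_indicator (A : Set Ω) (a : ℝ) (w : Ω) :
    Real.exp (A.indicator (fun _ => a) w) = 1 + A.indicator (fun _ => Real.exp a - 1) w := by
  by_cases h : w ∈ A <;> simp [h]

lemma integrable_exp_indicator [MeasurableSpace Ω] (μ : Measure Ω) [IsProbabilityMeasure μ]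
    {A : Set Ω} (hA : MeasurableSet A) (a : ℝ) :
    Integrable (fun w => Real.exp (A.indicator (fun _ => a) w)) μ := by
  simp_rw [exp_indicator]
  exact (integrable_const _).add ((integrable_const _).indicator hA)

lemma integral_exp_indicator [MeasurableSpace Ω] (μ : Measure Ω) [IsProbabilityMeasure μ]
    {A : Set Ω} (hA : MeasurableSet A) (a : ℝ) :
    ∫ w, Real.exp (A.indicator (fun _ => a) w) ∂μ = 1 + μ.real A * (Real.exp a - 1) := by
  simp_rw [exp_indicator]
  rw [integral_add (integrable_const _) ((integrable_const _).indicator hA),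
    integral_indicator_const _ hA]
  simp

lemma sum_indicator_eq_card {m : ℕ} (A : Set Ω) (a : ℝ) (s : Fin m → Ω) :
    ∑ j, A.indicator (fun _ => a) (s j) = a * (Finset.univ.filter fun j => s j ∈ A).card := by
  simp [Set.indicator_apply, Finset.sum_ite, mul_comm]

/-- Upper tail of the number of draws that fall into `A`. -/
lemma measure_pi_card_ge_le [MeasurableSpace Ω] (μ : Measure Ω) [IsProbabilityMeasure μ] {A : Set Ω}
    (hA : MeasurableSet A) {p a : ℝ} (hp : μ.real A ≤ p) (ha : 0 < a) (m : ℕ) (y : ℝ) :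
    Measure.pi (fun _ : Fin m => μ) {s | y ≤ (Finset.univ.filter fun j => s j ∈ A).card} ≤
      ENNReal.ofReal (Real.exp (m * (p * (Real.exp a - 1)) - a * y)) := by
  have he : 0 ≤ Real.exp a - 1 := by linarith [Real.add_one_le_exp a]
  have h := measure_pi_sum_ge_le μ (integrable_exp_indicator μ hA a)
    (B := p * (Real.exp a - 1)) (by
      rw [integral_exp_indicator μ hA]
      nlinarith [Real.add_one_le_exp (p * (Real.exp a - 1)),
        mul_le_mul_of_nonneg_right hp he]) m (a * y)
  refine le_trans (measure_mono fun s hs => ?_) h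
  simp only [mem_ofPred_eq, sum_indicator_eq_card] at hs ⊢
  exact mul_le_mul_of_nonneg_left hs ha.le

/-- Lower tail of the number of draws that fall into `A`. -/
lemma measure_pi_card_le_le [MeasurableSpace Ω] (μ : Measure Ω) [IsProbabilityMeasure μ] {A : Set Ω}
    (hA : MeasurableSet A) {p a : ℝ} (hp : p ≤ μ.real A) (ha : 0 < a) (m : ℕ) (y : ℝ) :
    Measure.pi (fun _ : Fin m => μ) {s | ((Finset.univ.filter fun j => s j ∈ A).card : ℝ) ≤ y} ≤
      ENNReal.ofReal (Real.exp (m * (p * (Real.exp (-a) - 1)) + a * y)) := by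
  have he : 0 ≤ 1 - Real.exp (-a) := by
    have := Real.exp_le_one_iff.2 (neg_nonpos.2 ha.le); linarith
  have h := measure_pi_sum_ge_le μ (integrable_exp_indicator μ hA (-a))
    (B := p * (Real.exp (-a) - 1)) (by
      rw [integral_exp_indicator μ hA]
      nlinarith [Real.add_one_le_exp (p * (Real.exp (-a) - 1)),
        mul_le_mul_of_nonneg_right hp he]) m (-(a * y))
  rw [sub_neg_eq_add] at h
  refine le_trans (measure_mono fun s hs => ?_) h
  simp only [mem_ofPred_eq, sum_indicator_eq_card] at hs ⊢
  nlinarith [mul_le_mul_of_nonneg_left hs ha.le]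

end Tail

/-! ### Resampling coordinates of an infinite product -/

section Resample

variable {ι S T : Type*} [MeasurableSpace S] [MeasurableSpace T]

/-- If every coordinate of a product measure is replaced by a measure-preserving function of itself
and of an independent variable, the law does not change. -/
lemma map_resample (μ : Measure S) [IsProbabilityMeasure μ] (ν : Measure T) [IsProbabilityMeasure ν]
    {rep : ι → S × T → S} (hrep : ∀ i, MeasurePreserving (rep i) (μ.prod ν) μ) :
    ((Measure.infinitePi fun _ : ι => μ).prod (Measure.infinitePi fun _ : ι => ν)).map
      (fun p i => rep i (p.1 i, p.2 i)) = Measure.infinitePi fun _ : ι => μ := by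
  have hm : Measurable (fun (p : (ι → S) × (ι → T)) i => rep i (p.1 i, p.2 i)) := by
    refine measurable_pi_lambda _ fun i => (hrep i).measurable.comp ?_
    fun_prop
  refine Measure.eq_infinitePi _ fun s t ht => ?_
  rw [Measure.map_apply hm (MeasurableSet.pi s.countable_toSet fun i _ => ht i)]
  -- Only the coordinates in `s` matter, and for these the two products can be zipped together.
  have h1 : (fun (p : (ι → S) × (ι → T)) i => rep i (p.1 i, p.2 i)) ⁻¹' (Set.pi s t) =
      (Prod.map s.restrict s.restrict) ⁻¹' ((MeasurableEquiv.arrowProdEquivProdArrow S T s).symm ⁻¹'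
        (Set.pi univ fun i : s => rep i ⁻¹' t i)) := by
    ext p
    simp [MeasurableEquiv.arrowProdEquivProdArrow, Equiv.arrowProdEquivProdArrow, Set.mem_pi]
  have hbox : MeasurableSet (Set.pi univ fun i : s => rep i ⁻¹' t i) :=
    MeasurableSet.univ_pi fun i => (hrep i).measurable (ht i)
  have hR : MeasurePreserving (s.restrict (π := fun _ => S)) (Measure.infinitePi fun _ : ι => μ)
      (Measure.pi fun _ : s => μ) :=
    ⟨by fun_prop, Measure.infinitePi_map_restrict _⟩
  have hR' : MeasurePreserving (s.restrict (π := fun _ => T)) (Measure.infinitePi fun _ : ι => ν)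
      (Measure.pi fun _ : s => ν) :=
    ⟨by fun_prop, Measure.infinitePi_map_restrict _⟩
  have hZ := (measurePreserving_arrowProdEquivProdArrow S T s (fun _ => μ) (fun _ => ν)).symm
  rw [h1, (hR.prod hR').measure_preimage (hZ.measurable hbox).nullMeasurableSet,
    hZ.measure_preimage hbox.nullMeasurableSet, Measure.pi_pi]
  rw [← Finset.prod_coe_sort s fun i => μ (t i)]
  exact Finset.prod_congr rfl fun i _ => (hrep i).measure_preimage (ht i).nullMeasurableSet

/-- A measurable event is improbable if it becomes improbable after resampling, whatever the values
before the resampling. -/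
lemma measure_le_of_resample (μ : Measure S) [IsProbabilityMeasure μ] (ν : Measure T)
    [IsProbabilityMeasure ν] {rep : ι → S × T → S}
    (hrep : ∀ i, MeasurePreserving (rep i) (μ.prod ν) μ) {E : Set (ι → S)} (hE : MeasurableSet E)
    {p : ENNReal}
    (h : ∀ ω : ι → S,
      (Measure.infinitePi fun _ : ι => ν) {τ | (fun i => rep i (ω i, τ i)) ∈ E} ≤ p) :
    (Measure.infinitePi fun _ : ι => μ) E ≤ p := by
  have hm : Measurable (fun (p : (ι → S) × (ι → T)) i => rep i (p.1 i, p.2 i)) := by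
    refine measurable_pi_lambda _ fun i => (hrep i).measurable.comp ?_
    fun_prop
  rw [← map_resample μ ν hrep, Measure.map_apply hm hE, Measure.prod_apply (hm hE)]
  refine (lintegral_mono (g := fun _ => p) h).trans ?_
  simp

/-- Finitely many coordinates of an infinite product, in any order. -/
lemma measurePreserving_reindex (ν : Measure T) [IsProbabilityMeasure ν] {m : ℕ} (e : Fin m → ι)
    (he : Function.Injective e) :
    MeasurePreserving (fun (τ : ι → T) j => τ (e j)) (Measure.infinitePi fun _ : ι => ν)
      (Measure.pi fun _ : Fin m => ν) := by
  have hm : Measurable (fun (τ : ι → T) j => τ (e j)) := by fun_prop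
  refine ⟨hm, ?_⟩
  refine (Measure.pi_eq fun t ht => ?_).symm
  rw [Measure.map_apply hm (MeasurableSet.univ_pi ht)]
  have h1 : (fun (τ : ι → T) j => τ (e j)) ⁻¹' (Set.pi univ t) =
      Set.pi (Finset.univ.image e : Finset ι) fun i => ⋂ (j : Fin m) (_ : e j = i), t j := by
    ext τ
    simp only [mem_preimage, Set.mem_pi, mem_univ, forall_const, Finset.coe_image, Finset.coe_univ,
      image_univ, mem_range, mem_iInter, forall_exists_index]
    exact ⟨fun h i j hj k hk => hk ▸ h k, fun h j => h _ j rfl j rfl⟩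
  rw [h1, Measure.infinitePi_pi _ fun i _ => MeasurableSet.iInter fun j =>
    MeasurableSet.iInter fun _ => ht j, Finset.prod_image (fun a _ b _ h => he h)]
  refine Finset.prod_congr rfl fun j _ => ?_
  congr 1
  ext x
  simp [he.eq_iff]

end Resample

/-! ### Uniform convergence for classes of finite VC dimension -/

section Sauer

variable {X : Type*}

/-- The labellings of the points `x b` realized by `H`, each given by its set of positive points. -/
noncomputable def patterns {β : Type*} [Fintype β] (H : Set (Classifier X)) (x : β → X) :
    Finset (Finset β) :=
  Finset.univ.filter fun A => ∃ h ∈ H, ∀ b, b ∈ A ↔ h (x b) = true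

lemma card_le_of_patterns_shatters {β : Type*} [Fintype β] {H : Set (Classifier X)} {d : ℕ}
    (hd : vcDim H = d) {x : β → X} {B : Finset β} (hB : (patterns H x).Shatters B) :
    B.card ≤ d := by
  have hinj : Set.InjOn x B := by
    intro b hb c hc hbc
    by_contra hne
    obtain ⟨u, hu, hBu⟩ := hB (t := {b}) (by simpa using hb)
    simp only [patterns, Finset.mem_filter, Finset.mem_univ, true_and] at hu
    obtain ⟨h, -, hh⟩ := hu
    have h1 : b ∈ u := (Finset.mem_inter.1 (hBu ▸ Finset.mem_singleton_self b)).2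
    have h2 : c ∈ u := by rw [hh, ← hbc, ← hh]; exact h1
    have h3 : c ∈ B ∩ u := Finset.mem_inter.2 ⟨hc, h2⟩
    rw [hBu, Finset.mem_singleton] at h3
    exact hne h3.symm
  have hS : Shatters H (B.image x) := by
    intro g
    obtain ⟨u, hu, hBu⟩ := hB (t := B.filter fun b => g (x b) = true) (Finset.filter_subset _ _)
    simp only [patterns, Finset.mem_filter, Finset.mem_univ, true_and] at hu
    obtain ⟨h, hH, hh⟩ := hu
    refine ⟨h, hH, fun y hy => ?_⟩
    obtain ⟨b, hb, rfl⟩ := Finset.mem_image.1 hy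
    have : b ∈ u ↔ g (x b) = true := by
      have := congrArg (b ∈ ·) hBu
      simpa [hb] using this
    rw [hh] at this
    exact Bool.eq_iff_iff.2 this
  have h1 : ((B.image x).card : ℕ∞) ≤ vcDim H := le_iSup₂_of_le (B.image x) hS le_rfl
  rw [hd, Finset.card_image_of_injOn hinj] at h1
  exact_mod_cast h1

/-- The Sauer-Shelah bound. -/
lemma card_patterns_le {β : Type*} [Fintype β] {H : Set (Classifier X)} {d : ℕ}
    (hd : vcDim H = d) (x : β → X) :
    (patterns H x).card ≤ ∑ i ∈ Finset.Iic d, (Fintype.card β).choose i := by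
  refine (Finset.card_le_card_shatterer _).trans (Finset.card_shatterer_le_sum_vcDim.trans ?_)
  refine Finset.sum_le_sum_of_subset (Finset.Iic_subset_Iic.2 ?_)
  exact Finset.sup_le fun B hB => card_le_of_patterns_shatters hd (Finset.mem_shatterer.1 hB)

/-- A bound for the growth function with a free parameter `t`, which avoids the usual division
by `d`. -/
lemma sum_choose_le {d N : ℕ} {t : ℝ} (ht : 0 < t) (ht1 : t ≤ 1) :
    ((∑ i ∈ Finset.Iic d, N.choose i : ℕ) : ℝ) ≤ (1 / t) ^ d * Real.exp (t * N) := by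
  have h1 : ∑ i ∈ Finset.Iic d, (N.choose i : ℝ) * t ^ i ≤ Real.exp (t * N) := by
    calc ∑ i ∈ Finset.Iic d, (N.choose i : ℝ) * t ^ i
        ≤ ∑ i ∈ Finset.range (N + 1), (N.choose i : ℝ) * t ^ i := by
          rw [← Finset.sum_filter_add_sum_filter_not (Finset.Iic d) (fun i => i ≤ N)]
          have hz : ∑ i ∈ (Finset.Iic d).filter (fun i => ¬ i ≤ N), (N.choose i : ℝ) * t ^ i = 0 :=
            Finset.sum_eq_zero fun i hi => by
              rw [Nat.choose_eq_zero_of_lt (not_le.1 (Finset.mem_filter.1 hi).2)]; simp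
          rw [hz, add_zero]
          refine Finset.sum_le_sum_of_subset_of_nonneg (fun i hi => ?_) fun _ _ _ => by positivity
          have := (Finset.mem_filter.1 hi).2
          exact Finset.mem_range.2 (by omega)
      _ = (t + 1) ^ N := by
          rw [add_pow]
          exact Finset.sum_congr rfl fun i _ => by simp [mul_comm]
      _ ≤ Real.exp t ^ N := by gcongr; exact Real.add_one_le_exp t
      _ = Real.exp (t * N) := by rw [← Real.exp_nat_mul, mul_comm]
  calc ((∑ i ∈ Finset.Iic d, N.choose i : ℕ) : ℝ)
      ≤ ∑ i ∈ Finset.Iic d, (1 / t) ^ d * ((N.choose i : ℝ) * t ^ i) := by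
        push_cast
        refine Finset.sum_le_sum fun i hi => ?_
        have hid : i ≤ d := Finset.mem_Iic.1 hi
        have : (1 : ℝ) ≤ (1 / t) ^ d * t ^ i := by
          rw [one_div, inv_pow, inv_mul_eq_div, one_le_div (by positivity)]
          exact pow_le_pow_of_le_one ht.le ht1 hid
        nlinarith [Nat.cast_nonneg (α := ℝ) (N.choose i)]
    _ = (1 / t) ^ d * ∑ i ∈ Finset.Iic d, (N.choose i : ℝ) * t ^ i := by rw [Finset.mul_sum]
    _ ≤ _ := by gcongr

end Sauer

section Symmetrization

/-- The sample and the ghost sample after an exchange of their entries at the places with `σ j`. -/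
def swapSample {Ω : Type*} {m : ℕ} (σ : Fin m → Bool) (p : (Fin m → Ω) × (Fin m → Ω)) :
    (Fin m → Ω) × (Fin m → Ω) :=
  (fun j => if σ j then p.2 j else p.1 j, fun j => if σ j then p.1 j else p.2 j)

lemma measurePreserving_swapSample {Ω : Type*} [MeasurableSpace Ω] (μ : Measure Ω)
    [IsProbabilityMeasure μ] {m : ℕ} (σ : Fin m → Bool) :
    MeasurePreserving (swapSample σ)
      ((Measure.pi fun _ : Fin m => μ).prod (Measure.pi fun _ : Fin m => μ))
      ((Measure.pi fun _ : Fin m => μ).prod (Measure.pi fun _ : Fin m => μ)) := by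
  have hZ := measurePreserving_arrowProdEquivProdArrow Ω Ω (Fin m) (fun _ => μ) (fun _ => μ)
  have hS : MeasurePreserving (fun (p : Fin m → Ω × Ω) j => (if σ j then Prod.swap else id) (p j))
      (Measure.pi fun _ : Fin m => μ.prod μ) (Measure.pi fun _ : Fin m => μ.prod μ) := by
    refine measurePreserving_pi (fun _ => μ.prod μ) (fun _ => μ.prod μ) fun j => ?_
    by_cases h : σ j
    · simpa [h] using Measure.measurePreserving_swap
    · simpa [h] using MeasurePreserving.id _
  have h := (hZ.comp hS).comp hZ.symm
  convert h using 1
  funext p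
  refine Prod.ext (funext fun j => ?_) (funext fun j => ?_) <;>
    by_cases h : σ j <;>
    simp [swapSample, MeasurableEquiv.arrowProdEquivProdArrow, Equiv.arrowProdEquivProdArrow, h]

/-- Losses on the ghost sample are rewarded at rate `0.05` and losses on the sample punished at the
slightly larger rate `0.055`: then a random exchange of the two examples of a pair gains nothing. -/
lemma exp_loss_add_exp_loss_le_two (p q : Prop) [Decidable p] [Decidable q] :
    Real.exp (0.05 * (if q then 1 else 0) - 0.055 * (if p then 1 else 0)) +
      Real.exp (0.05 * (if p then 1 else 0) - 0.055 * (if q then 1 else 0)) ≤ 2 := by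
  have h1 : Real.exp (0.05 : ℝ) ≤ 1.0525 := by
    have := abs_le.1 (Real.abs_exp_sub_one_sub_id_le (x := (0.05 : ℝ)) (by norm_num [abs_le]))
    norm_num at this ⊢; linarith [this.2]
  have h2 : Real.exp (-0.055 : ℝ) ≤ 0.947 := by
    have := Real.quadratic_le_exp_of_nonneg (x := (0.055 : ℝ)) (by norm_num)
    rw [Real.exp_neg, inv_le_comm₀ (Real.exp_pos _) (by norm_num)]
    refine le_trans (by norm_num) this
  have h3 : Real.exp (0.05 - 0.055 : ℝ) ≤ 1 := Real.exp_le_one_iff.2 (by norm_num)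
  by_cases hp : p <;> by_cases hq : q <;> simp only [hp, hq, if_true, if_false]
  · simp only [mul_one]; linarith
  · simp only [mul_one, mul_zero, sub_zero, zero_sub]; linarith
  · simp only [mul_one, mul_zero, sub_zero, zero_sub]; linarith
  · norm_num

variable {X Ω : Type*} {m : ℕ}

/-- The exponential weight that compares the losses of `h` on the ghost sample and the sample. -/
noncomputable def ghostWeight (Z : Ω → LExample X) (h : Classifier X)
    (p : (Fin m → Ω) × (Fin m → Ω)) : ℝ :=
  ∏ j, Real.exp (0.05 * (if h (Z (p.2 j)).1 ≠ (Z (p.2 j)).2 then 1 else 0) -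
    0.055 * (if h (Z (p.1 j)).1 ≠ (Z (p.1 j)).2 then 1 else 0))

/-- Symmetrization for a fixed double sample: over all exchanges, the weights of classifiers that
depend on the exchanged sample average to at most the number of realized labellings. -/
lemma sum_ghostWeight_swap_le {H : Set (Classifier X)} {d : ℕ} (hd : vcDim H = d)
    (Z : Ω → LExample X) (G : (Fin m → Ω) → Classifier X) (hG : ∀ s, G s ∈ H)
    (p : (Fin m → Ω) × (Fin m → Ω)) :
    ∑ σ : Fin m → Bool, ghostWeight Z (G (swapSample σ p).1) (swapSample σ p) ≤
      2 ^ m * ((∑ i ∈ Finset.Iic d, (2 * m).choose i : ℕ) : ℝ) := by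
  -- `(j, false)` and `(j, true)` stand for the two examples of the pair `j`.
  let w : Fin m × Bool → Ω := fun b => if b.2 then p.2 b.1 else p.1 b.1
  let loss : Finset (Fin m × Bool) → Fin m × Bool → Prop := fun A b =>
    ¬ (b ∈ A ↔ (Z (w b)).2 = true)
  let ψ : Finset (Fin m × Bool) → Fin m → Bool → ℝ := fun A j c =>
    Real.exp (0.05 * (if loss A (j, !c) then 1 else 0) - 0.055 * (if loss A (j, c) then 1 else 0))
  have hψ : ∀ A j, ∑ c, ψ A j c ≤ 2 := by
    intro A j
    rw [Fintype.sum_bool, add_comm]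
    exact exp_loss_add_exp_loss_le_two _ _
  have h1 : ∀ σ : Fin m → Bool, ghostWeight Z (G (swapSample σ p).1) (swapSample σ p) ≤
      ∑ A ∈ patterns H (fun b => (Z (w b)).1), ∏ j, ψ A j (σ j) := by
    intro σ
    set h := G (swapSample σ p).1 with hh
    let A : Finset (Fin m × Bool) := Finset.univ.filter fun b => h (Z (w b)).1 = true
    have hA : A ∈ patterns H (fun b => (Z (w b)).1) := by
      simp only [patterns, Finset.mem_filter, Finset.mem_univ, true_and]
      exact ⟨h, hG _, fun b => by simp [A]⟩
    have hl : ∀ b, loss A b ↔ h (Z (w b)).1 ≠ (Z (w b)).2 := by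
      intro b
      simp only [loss, A, Finset.mem_filter, Finset.mem_univ, true_and, ne_eq]
      exact not_congr Bool.eq_iff_iff.symm
    refine le_trans (le_of_eq ?_) (Finset.single_le_sum (f := fun A => ∏ j, ψ A j (σ j))
      (fun A _ => Finset.prod_nonneg fun j _ => (Real.exp_pos _).le) hA)
    refine Finset.prod_congr rfl fun j _ => ?_
    simp only [ψ, hl]
    cases hσ : σ j <;> simp [w, swapSample, hσ]
  have h2 : ∀ A, ∑ σ : Fin m → Bool, ∏ j, ψ A j (σ j) ≤ 2 ^ m := by
    intro A
    have := Finset.prod_univ_sum (fun _ : Fin m => (Finset.univ : Finset Bool)) (fun j c => ψ A j c)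
    rw [Fintype.piFinset_univ] at this
    rw [← this]
    calc ∏ j, ∑ c, ψ A j c ≤ ∏ _j : Fin m, (2 : ℝ) :=
          Finset.prod_le_prod (fun j _ => Finset.sum_nonneg fun c _ => (Real.exp_pos _).le)
            fun j _ => hψ A j
      _ = 2 ^ m := by simp
  calc ∑ σ : Fin m → Bool, ghostWeight Z (G (swapSample σ p).1) (swapSample σ p)
      ≤ ∑ σ : Fin m → Bool, ∑ A ∈ patterns H (fun b => (Z (w b)).1), ∏ j, ψ A j (σ j) :=
        Finset.sum_le_sum fun σ _ => h1 σ
    _ = ∑ A ∈ patterns H (fun b => (Z (w b)).1), ∑ σ : Fin m → Bool, ∏ j, ψ A j (σ j) :=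
        Finset.sum_comm
    _ ≤ ∑ A ∈ patterns H (fun b => (Z (w b)).1), (2 : ℝ) ^ m := Finset.sum_le_sum fun A _ => h2 A
    _ = 2 ^ m * (patterns H (fun b => (Z (w b)).1)).card := by simp [mul_comm]
    _ ≤ _ := by
        gcongr
        refine (card_patterns_le hd _).trans (le_of_eq ?_)
        simp [Fintype.card_prod, mul_comm]

variable [MeasurableSpace Ω]

lemma measurable_ghostWeight (Z : Ω → LExample X) (G : (Fin m → Ω) → Classifier X)
    (hM : MeasurableSet {p : (Fin m → Ω) × Ω | G p.1 (Z p.2).1 ≠ (Z p.2).2}) :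
    Measurable fun p : (Fin m → Ω) × (Fin m → Ω) => ghostWeight Z (G p.1) p := by
  refine Finset.measurable_prod _ fun j _ => Real.measurable_exp.comp ?_
  have h2 : MeasurableSet {p : (Fin m → Ω) × (Fin m → Ω) |
      G p.1 (Z (p.2 j)).1 ≠ (Z (p.2 j)).2} :=
    hM.preimage (f := fun p : (Fin m → Ω) × (Fin m → Ω) => (p.1, p.2 j)) (by fun_prop)
  have h1 : MeasurableSet {p : (Fin m → Ω) × (Fin m → Ω) |
      G p.1 (Z (p.1 j)).1 ≠ (Z (p.1 j)).2} :=
    hM.preimage (f := fun p : (Fin m → Ω) × (Fin m → Ω) => (p.1, p.1 j)) (by fun_prop)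
  exact ((Measurable.ite h2 measurable_const measurable_const).const_mul _).sub
    ((Measurable.ite h1 measurable_const measurable_const).const_mul _)

/-- Given the sample, the ghost sample is an independent one, on which the learned classifier has a
binomial number of losses. -/
lemma lintegral_ghostWeight (μ : Measure Ω) [IsProbabilityMeasure μ] (Z : Ω → LExample X)
    (h : Classifier X) (hM : MeasurableSet {w | h (Z w).1 ≠ (Z w).2}) (s : Fin m → Ω) :
    ∫⁻ s', ENNReal.ofReal (ghostWeight Z h (s, s')) ∂(Measure.pi fun _ : Fin m => μ) =
      ENNReal.ofReal ((1 + μ.real {w | h (Z w).1 ≠ (Z w).2} * (Real.exp 0.05 - 1)) ^ m *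
        Real.exp (-(0.055 * (Finset.univ.filter fun j => h (Z (s j)).1 ≠ (Z (s j)).2).card))) := by
  set A := {w | h (Z w).1 ≠ (Z w).2} with hA
  have h1 : ∀ s', ghostWeight Z h (s, s') =
      (∏ j : Fin m, Real.exp (A.indicator (fun _ => 0.05) (s' j))) *
        Real.exp (-(0.055 * (Finset.univ.filter fun j => h (Z (s j)).1 ≠ (Z (s j)).2).card)) := by
    intro s'
    have : Real.exp (-(0.055 * (Finset.univ.filter fun j => h (Z (s j)).1 ≠ (Z (s j)).2).card)) =
        ∏ j, Real.exp (-(0.055 * if h (Z (s j)).1 ≠ (Z (s j)).2 then 1 else 0)) := by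
      rw [← Real.exp_sum]
      congr 1
      rw [Finset.sum_neg_distrib, ← Finset.mul_sum, Finset.sum_boole]
    rw [this, ← Finset.prod_mul_distrib]
    refine Finset.prod_congr rfl fun j _ => ?_
    rw [← Real.exp_add, ← sub_eq_add_neg]
    congr 2
    by_cases hj : s' j ∈ A
    · rw [indicator_of_mem hj]; rw [if_pos (by simpa [hA] using hj)]; ring
    · rw [indicator_of_notMem hj]; rw [if_neg (by simpa [hA] using hj)]; ring
  have hint := integrable_exp_indicator μ hM 0.05
  simp_rw [h1]
  rw [← ofReal_integral_eq_lintegral_ofReal]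
  · rw [integral_mul_const, integral_fintype_prod_eq_pow (ι := Fin m) (μ := μ)
      (fun w => Real.exp (A.indicator (fun _ => (0.05 : ℝ)) w)), integral_exp_indicator μ hM]
    simp
  · exact (Integrable.fintype_prod (fun _ => hint)).mul_const _
  · exact Filter.Eventually.of_forall fun s' => by positivity

/-- The uniform convergence bound, for a classifier `G s` that is learned from the sample `s` and
jointly measurable: it rarely has few losses on the sample but a large expected loss. No
measurability of the class is needed. -/
lemma measure_pi_learned_le {H : Set (Classifier X)} {d : ℕ} (hd : vcDim H = d) (μ : Measure Ω)
    [IsProbabilityMeasure μ] (Z : Ω → LExample X) (G : (Fin m → Ω) → Classifier X)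
    (hG : ∀ s, G s ∈ H)
    (hM : MeasurableSet {p : (Fin m → Ω) × Ω | G p.1 (Z p.2).1 ≠ (Z p.2).2})
    {u v : ℝ} (hv : 0 ≤ v) :
    Measure.pi (fun _ : Fin m => μ) {s |
        ((Finset.univ.filter fun j => G s (Z (s j)).1 ≠ (Z (s j)).2).card : ℝ) ≤ u ∧
        v ≤ μ.real {w | G s (Z w).1 ≠ (Z w).2}} ≤
      ENNReal.ofReal (((∑ i ∈ Finset.Iic d, (2 * m).choose i : ℕ) : ℝ) * Real.exp (0.055 * u) /
        (1 + v * (Real.exp 0.05 - 1)) ^ m) := by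
  set Q := Measure.pi (fun _ : Fin m => μ)
  set N : ℝ := ((∑ i ∈ Finset.Iic d, (2 * m).choose i : ℕ) : ℝ)
  set F : (Fin m → Ω) × (Fin m → Ω) → ENNReal := fun p => ENNReal.ofReal (ghostWeight Z (G p.1) p)
  have hF : Measurable F := (measurable_ghostWeight Z G hM).ennreal_ofReal
  have he : 0 ≤ Real.exp 0.05 - 1 := by linarith [Real.add_one_le_exp 0.05]
  have hpos : ∀ h p, 0 ≤ ghostWeight (m := m) Z h p := fun h p =>
    Finset.prod_nonneg fun j _ => (Real.exp_pos _).le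
  have hup : ∫⁻ p, F p ∂(Q.prod Q) ≤ ENNReal.ofReal N := by
    have hswap : ∀ σ : Fin m → Bool, ∫⁻ p, F (swapSample σ p) ∂(Q.prod Q) = ∫⁻ p, F p ∂(Q.prod Q) :=
      fun σ => (measurePreserving_swapSample μ σ).lintegral_comp hF
    have hsum : (2 : ENNReal) ^ m * ∫⁻ p, F p ∂(Q.prod Q) ≤ 2 ^ m * ENNReal.ofReal N := by
      calc (2 : ENNReal) ^ m * ∫⁻ p, F p ∂(Q.prod Q)
          = ∑ σ : Fin m → Bool, ∫⁻ p, F (swapSample σ p) ∂(Q.prod Q) := by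
            simp_rw [hswap]; simp
        _ = ∫⁻ p, ∑ σ : Fin m → Bool, F (swapSample σ p) ∂(Q.prod Q) :=
            (lintegral_finsetSum _ fun σ _ =>
              hF.comp (measurePreserving_swapSample μ σ).measurable).symm
        _ ≤ ∫⁻ _, ENNReal.ofReal (2 ^ m * N) ∂(Q.prod Q) := by
            refine lintegral_mono fun p => ?_
            simp only [F]
            rw [← ENNReal.ofReal_sum_of_nonneg fun σ _ => hpos _ _]
            exact ENNReal.ofReal_le_ofReal (sum_ghostWeight_swap_le hd Z G hG p)
        _ = 2 ^ m * ENNReal.ofReal N := by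
            rw [lintegral_const, measure_univ, mul_one, ENNReal.ofReal_mul (by positivity),
              ENNReal.ofReal_pow (by norm_num)]
            simp
    exact (ENNReal.mul_le_mul_iff_right (by simp) (by simp)).1 hsum
  set L : ℝ := (1 + v * (Real.exp 0.05 - 1)) ^ m * Real.exp (-(0.055 * u))
  have hL : 0 < L := by positivity
  have hlow : ∀ s, ((Finset.univ.filter fun j => G s (Z (s j)).1 ≠ (Z (s j)).2).card : ℝ) ≤ u ∧
      v ≤ μ.real {w | G s (Z w).1 ≠ (Z w).2} → ENNReal.ofReal L ≤ ∫⁻ s', F (s, s') ∂Q := by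
    rintro s ⟨hu, hv'⟩
    simp only [F]
    rw [lintegral_ghostWeight μ Z (G s)
      (hM.preimage (f := fun w : Ω => (s, w)) (by fun_prop)) s]
    refine ENNReal.ofReal_le_ofReal ?_
    simp only [L]
    gcongr
  have hmark := mul_meas_ge_le_lintegral₀ (μ := Q) (f := fun s => ∫⁻ s', F (s, s') ∂Q)
    hF.lintegral_prod_right'.aemeasurable (ENNReal.ofReal L)
  rw [← lintegral_prod _ hF.aemeasurable] at hmark
  have hE := (mul_le_mul_right (measure_mono (μ := Q) hlow) (ENNReal.ofReal L)).trans
    (hmark.trans hup)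
  have : N * Real.exp (0.055 * u) / (1 + v * (Real.exp 0.05 - 1)) ^ m = N / L := by
    simp only [L, Real.exp_neg]
    field_simp
  rw [this, ENNReal.ofReal_div_of_pos hL,
    ENNReal.le_div_iff_mul_le (by simp [hL]) (by simp), mul_comm]
  exact hE

end Symmetrization

/-! ### The law of a slot and of a draw from a mixture -/

section SlotLaw

variable {X : Type*} [MeasurableSpace X] {k : ℕ}

/-- The law of a single slot. -/
noncomputable def slotLaw (D : Fin k → Measure (LExample X)) : Measure (Slot X k) :=
  (volume : Measure unitInterval).prod ((Measure.pi D).prod (Measure.pi D))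

instance (D : Fin k → Measure (LExample X)) [∀ i, IsProbabilityMeasure (D i)] :
    IsProbabilityMeasure (slotLaw D) := by
  unfold slotLaw; infer_instance

lemma drawLaw_eq (D : Fin k → Measure (LExample X)) :
    drawLaw D = Measure.infinitePi fun _ => slotLaw D := rfl

/-- Replaces the test examples of a slot. -/
def replaceTest (p : Slot X k × (Fin k → LExample X)) : Slot X k := (p.1.1, p.1.2.1, p.2)

lemma measurePreserving_replaceTest (D : Fin k → Measure (LExample X))
    [∀ i, IsProbabilityMeasure (D i)] :
    MeasurePreserving replaceTest ((slotLaw D).prod (Measure.pi D)) (slotLaw D) := by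
  have h1 : MeasurePreserving
      (Prod.map id Prod.fst : Slot X k → unitInterval × (Fin k → LExample X))
      (slotLaw D) ((volume : Measure unitInterval).prod (Measure.pi D)) :=
    (MeasurePreserving.id _).prod measurePreserving_fst
  exact (measurePreserving_prodAssoc volume (Measure.pi D) (Measure.pi D)).comp
    (h1.prod (MeasurePreserving.id (Measure.pi D)))

/-- The example drawn from the mixture with weights `α`. -/
noncomputable def mixDraw [NeZero k] (α : Fin k → ℝ) (s : Slot X k) : LExample X :=
  s.mix (mixIndex α s.u)

lemma measurable_mixIndex [NeZero k] :
    Measurable fun p : (Fin k → ℝ) × ℝ => mixIndex p.1 p.2 := by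
  have h : Measurable fun p : (Fin k → ℝ) × ℝ =>
      (Finset.univ.filter fun i : Fin k => ∑ j ∈ Finset.Iic i, p.1 j < p.2 * ∑ j, p.1 j).card := by
    simp_rw [Finset.card_filter]
    refine Finset.measurable_sum _ fun i _ => Measurable.ite ?_ measurable_const measurable_const
    exact measurableSet_lt (by fun_prop) (by fun_prop)
  exact (measurable_from_top (f := fun n : ℕ => Fin.ofNat k n)).comp h

lemma measurable_mixDraw [NeZero k] :
    Measurable fun p : (Fin k → ℝ) × Slot X k => mixDraw p.1 p.2 := by
  have h1 : Measurable fun p : (Fin k → ℝ) × Slot X k => (p.2.2.1, mixIndex p.1 p.2.1) := by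
    refine Measurable.prodMk (by fun_prop) ?_
    exact measurable_mixIndex.comp (f := fun p : (Fin k → ℝ) × Slot X k => (p.1, (p.2.1 : ℝ)))
      (by fun_prop)
  have h2 : Measurable fun q : (Fin k → LExample X) × Fin k => q.1 q.2 :=
    measurable_from_prod_countable_left fun i => by fun_prop
  exact h2.comp h1

lemma measurable_mixDraw_right [NeZero k] (α : Fin k → ℝ) :
    Measurable fun s : Slot X k => mixDraw α s :=
  measurable_mixDraw.comp (f := fun s : Slot X k => (α, s)) (by fun_prop)

/-- The values of `u` between two consecutive partial sums of the weights, divided by the total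
weight, select the component `i`. -/
lemma mixIndex_eq [NeZero k] {α : Fin k → ℝ} (hα : ∀ i, 0 ≤ α i) (i : Fin k) {u : ℝ}
    (h1 : ∑ j ∈ Finset.Iio i, α j < u * ∑ j, α j) (h2 : u * ∑ j, α j ≤ ∑ j ∈ Finset.Iic i, α j) :
    mixIndex α u = i := by
  have : (Finset.univ.filter fun l : Fin k => ∑ j ∈ Finset.Iic l, α j < u * ∑ j, α j)
      = Finset.Iio i := by
    ext l
    simp only [Finset.mem_filter, Finset.mem_univ, true_and, Finset.mem_Iio]
    constructor
    · intro hl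
      by_contra hle
      have := Finset.sum_le_sum_of_subset_of_nonneg
        (Finset.Iic_subset_Iic.2 (not_lt.1 hle)) fun j _ _ => hα j
      linarith
    · intro hl
      refine lt_of_le_of_lt (Finset.sum_le_sum_of_subset_of_nonneg ?_ fun j _ _ => hα j) h1
      exact fun j hj => Finset.mem_Iio.2 (lt_of_le_of_lt (Finset.mem_Iic.1 hj) hl)
  rw [mixIndex, this, Fin.card_Iio]
  simp

lemma div_le_measureReal_mixIndex [NeZero k] {α : Fin k → ℝ} (hα : ∀ i, 0 < α i) (i : Fin k) :
    α i / ∑ j, α j ≤ (volume : Measure unitInterval).real {u | mixIndex α (u : ℝ) = i} := by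
  have hW : 0 < ∑ j, α j := Finset.sum_pos (fun j _ => hα j) Finset.univ_nonempty
  have hsplit : ∑ j ∈ Finset.Iic i, α j = ∑ j ∈ Finset.Iio i, α j + α i := by
    rw [← Finset.Iio_insert, Finset.sum_insert (by simp), add_comm]
  have h0 : 0 ≤ ∑ j ∈ Finset.Iio i, α j := Finset.sum_nonneg fun j _ => (hα j).le
  have h1 : ∑ j ∈ Finset.Iic i, α j ≤ ∑ j, α j :=
    Finset.sum_le_sum_of_subset_of_nonneg (Finset.subset_univ _) fun j _ _ => (hα j).le
  let a : unitInterval := ⟨(∑ j ∈ Finset.Iio i, α j) / ∑ j, α j, by positivity, by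
    rw [div_le_one hW]; linarith [hα i]⟩
  let b : unitInterval := ⟨(∑ j ∈ Finset.Iic i, α j) / ∑ j, α j,
    div_nonneg (by linarith [hα i]) hW.le, by rwa [div_le_one hW]⟩
  have hsub : Ioc a b ⊆ {u : unitInterval | mixIndex α (u : ℝ) = i} := by
    rintro u ⟨hu1, hu2⟩
    have hu1' : (∑ j ∈ Finset.Iio i, α j) / ∑ j, α j < (u : ℝ) := hu1
    have hu2' : (u : ℝ) ≤ (∑ j ∈ Finset.Iic i, α j) / ∑ j, α j := hu2
    exact mixIndex_eq (fun j => (hα j).le) i ((div_lt_iff₀ hW).1 hu1') ((le_div_iff₀ hW).1 hu2')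
  refine le_trans (le_of_eq ?_) (measureReal_mono hsub)
  have hba : (b : ℝ) - a = α i / ∑ j, α j := by
    simp only [a, b]; rw [hsplit]; ring
  rw [measureReal_def, unitInterval.volume_Ioc, hba, ENNReal.toReal_ofReal (by
    have := hα i; positivity)]

lemma measureReal_mixDraw [NeZero k] (D : Fin k → Measure (LExample X))
    [∀ i, IsProbabilityMeasure (D i)] (α : Fin k → ℝ) {A : Set (LExample X)}
    (hA : MeasurableSet A) :
    (slotLaw D).real {s | mixDraw α s ∈ A} =
      ∑ i, (volume : Measure unitInterval).real {u | mixIndex α (u : ℝ) = i} * (D i).real A := by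
  have hidx : ∀ i, MeasurableSet {u : unitInterval | mixIndex α (u : ℝ) = i} := fun i =>
    measurableSet_eq_fun (measurable_mixIndex.comp (f := fun u : unitInterval => (α, (u : ℝ)))
      (by fun_prop)) measurable_const
  let P : Fin k → Set (Slot X k) := fun i =>
    {u : unitInterval | mixIndex α (u : ℝ) = i} ×ˢ ((Function.eval i ⁻¹' A) ×ˢ univ)
  have hunion : {s : Slot X k | mixDraw α s ∈ A} = ⋃ i ∈ (Finset.univ : Finset (Fin k)), P i := by
    ext s
    simp [P, mixDraw, Slot.mix, Slot.u]
  have hP : ∀ i, MeasurableSet (P i) := fun i =>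
    (hidx i).prod ((hA.preimage (measurable_pi_apply i)).prod MeasurableSet.univ)
  rw [hunion, measureReal_biUnion_finset]
  · refine Finset.sum_congr rfl fun i _ => ?_
    simp only [P, slotLaw]
    rw [measureReal_prod_prod, measureReal_prod_prod, probReal_univ, mul_one]
    congr 1
    rw [measureReal_def, (measurePreserving_eval D i).measure_preimage hA.nullMeasurableSet]
    rfl
  · intro i _ j _ hij
    refine Set.disjoint_left.2 fun s hs hs' => hij ?_
    exact hs.1.symm.trans hs'.1
  · exact fun i _ => hP i

lemma sum_measureReal_mixIndex [NeZero k] (α : Fin k → ℝ) :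
    ∑ i, (volume : Measure unitInterval).real {u | mixIndex α (u : ℝ) = i} = 1 := by
  have hm : Measurable fun u : unitInterval => mixIndex α (u : ℝ) :=
    measurable_mixIndex.comp (f := fun u : unitInterval => (α, (u : ℝ))) (by fun_prop)
  have := sum_measureReal_preimage_singleton (μ := (volume : Measure unitInterval)) Finset.univ
    (f := fun u : unitInterval => mixIndex α (u : ℝ)) fun i _ => hm (measurableSet_singleton i)
  simpa [Set.preimage] using this

lemma measureReal_mixDraw_le [NeZero k] (D : Fin k → Measure (LExample X))
    [∀ i, IsProbabilityMeasure (D i)] (α : Fin k → ℝ) {A : Set (LExample X)}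
    (hA : MeasurableSet A) {p : ℝ} (hp : ∀ i, (D i).real A ≤ p) :
    (slotLaw D).real {s | mixDraw α s ∈ A} ≤ p := by
  rw [measureReal_mixDraw D α hA]
  calc _ ≤ ∑ i, (volume : Measure unitInterval).real {u | mixIndex α (u : ℝ) = i} * p :=
        Finset.sum_le_sum fun i _ => mul_le_mul_of_nonneg_left (hp i) measureReal_nonneg
    _ = p := by rw [← Finset.sum_mul, sum_measureReal_mixIndex, one_mul]

lemma le_measureReal_mixDraw [NeZero k] (D : Fin k → Measure (LExample X))
    [∀ i, IsProbabilityMeasure (D i)] {α : Fin k → ℝ} (hα : ∀ i, 0 < α i) {A : Set (LExample X)}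
    (hA : MeasurableSet A) :
    (∑ i, α i * (D i).real A) / ∑ i, α i ≤ (slotLaw D).real {s | mixDraw α s ∈ A} := by
  rw [measureReal_mixDraw D α hA, Finset.sum_div]
  refine Finset.sum_le_sum fun i _ => ?_
  rw [mul_div_right_comm]
  exact mul_le_mul_of_nonneg_right (div_le_measureReal_mixIndex hα i) measureReal_nonneg

/-- Upper tail of the number of test examples, over all distributions, that fall into `A`. -/
lemma measure_pi_sum_card_ge_le (D : Fin k → Measure (LExample X))
    [∀ i, IsProbabilityMeasure (D i)] {A : Set (LExample X)} (hA : MeasurableSet A) {p : ℝ}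
    (hp : ∀ i, (D i).real A ≤ p) (m : ℕ) (y : ℝ) :
    Measure.pi (fun _ : Fin m => Measure.pi D)
        {s | y ≤ ∑ i, ((Finset.univ.filter fun j => s j i ∈ A).card : ℝ)} ≤
      ENNReal.ofReal (Real.exp (m * (k * (2 * p)) - y)) := by
  let g : (Fin k → LExample X) → ℝ := fun t => ∑ i, A.indicator (fun _ => (1 : ℝ)) (t i)
  have hexp : ∀ t, Real.exp (g t) = ∏ i, Real.exp (A.indicator (fun _ => (1 : ℝ)) (t i)) :=
    fun t => Real.exp_sum _ _
  have hint : Integrable (fun t => Real.exp (g t)) (Measure.pi D) := by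
    simp_rw [hexp]
    exact Integrable.fintype_prod (f := fun _ z => Real.exp (A.indicator (fun _ => (1 : ℝ)) z))
      fun i => integrable_exp_indicator (D i) hA 1
  have he : Real.exp 1 - 1 ≤ 2 := by linarith [Real.exp_one_lt_d9]
  have he0 : 0 ≤ Real.exp 1 - 1 := by linarith [Real.add_one_le_exp 1]
  have hB : ∫ t, Real.exp (g t) ∂(Measure.pi D) ≤ Real.exp (k * (2 * p)) := by
    simp_rw [hexp]
    rw [integral_fintype_prod_eq_prod
      (fun (_ : Fin k) z => Real.exp (A.indicator (fun _ => (1 : ℝ)) z))]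
    calc _ ≤ ∏ _i : Fin k, Real.exp (2 * p) := by
          refine Finset.prod_le_prod (fun i _ => integral_nonneg fun _ => (Real.exp_pos _).le)
            fun i _ => ?_
          rw [integral_exp_indicator (D i) hA]
          have h0 : 0 ≤ (D i).real A := measureReal_nonneg
          nlinarith [Real.add_one_le_exp (2 * p), hp i]
      _ = Real.exp (k * (2 * p)) := by
          rw [Finset.prod_const, Finset.card_univ, Fintype.card_fin, ← Real.exp_nat_mul]
  refine le_trans (measure_mono fun s hs => ?_)
    (measure_pi_sum_ge_le (Measure.pi D) hint hB m y)
  simp only [mem_ofPred_eq] at hs ⊢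
  refine hs.trans (le_of_eq ?_)
  simp only [g]
  rw [Finset.sum_comm]
  refine Finset.sum_congr rfl fun i _ => ?_
  have := sum_indicator_eq_card A 1 fun j => s j i
  rw [this, one_mul]

end SlotLaw

/-! ### Disagreement regions and imputed labels -/

section Impute

variable {X : Type*}

lemma mem_DIS_iff {V : Set (Classifier X)} {x : X} :
    x ∈ DIS V ↔ (∃ h ∈ V, h x = true) ∧ ∃ h ∈ V, h x = false := by
  constructor
  · rintro ⟨h₁, m₁, h₂, m₂, hne⟩
    cases e₁ : h₁ x <;> cases e₂ : h₂ x <;> simp_all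
    · exact ⟨⟨h₂, m₂, e₂⟩, ⟨h₁, m₁, e₁⟩⟩
    · exact ⟨⟨h₁, m₁, e₁⟩, ⟨h₂, m₂, e₂⟩⟩
  · rintro ⟨⟨h₁, m₁, e₁⟩, ⟨h₂, m₂, e₂⟩⟩
    exact ⟨h₁, m₁, h₂, m₂, by simp [e₁, e₂]⟩

/-- A member of the version space errs on an imputed example only if it errs on the original one. -/
lemma ne_of_ne_impute {V : Set (Classifier X)} {h : Classifier X} (hh : h ∈ V) {z : LExample X}
    (hne : h z.1 ≠ (impute V z).2) : h z.1 ≠ z.2 := by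
  by_cases hz : z.1 ∈ DIS V
  · simpa [impute, hz] using hne
  · exfalso
    apply hne
    simp only [impute, hz, if_false]
    rw [mem_DIS_iff] at hz
    cases e : h z.1
    · symm
      simp only [decide_eq_false_iff_not]
      exact fun ht => hz ⟨ht, h, hh, e⟩
    · symm
      simp only [decide_eq_true_eq]
      exact ⟨h, hh, e⟩

/-- The error of `f` for the law of the imputed examples. -/
noncomputable def imputedErr [MeasurableSpace X] (D : Measure (LExample X)) (V : Set (Classifier X))
    (f : Classifier X) : ℝ :=
  D.real {z | f z.1 ≠ (impute V z).2}

lemma imputedErr_le_err [MeasurableSpace X] (D : Measure (LExample X)) [IsProbabilityMeasure D]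
    {V : Set (Classifier X)} {h : Classifier X} (hh : h ∈ V) : imputedErr D V h ≤ err D h :=
  measureReal_mono fun _ hz => ne_of_ne_impute hh hz

lemma card_le_of_empErr_le {m : ℕ} {S : Fin m → LExample X} {h : Classifier X} {c : ℝ}
    {P : Fin m → Prop} {_ : DecidablePred P} (hP : ∀ j, P j ↔ h (S j).1 ≠ (S j).2)
    (hc : empErr S h ≤ c) :
    ((Finset.univ.filter P).card : ℝ) ≤ c * m := by
  simp_rw [hP]
  rcases Nat.eq_zero_or_pos m with rfl | hm
  · simp
  · have : (0 : ℝ) < m := by exact_mod_cast hm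
    exact (div_le_iff₀ this).1 hc

lemma le_card_of_lt_empErr {m : ℕ} {S : Fin m → LExample X} {h : Classifier X} {c : ℝ}
    {P : Fin m → Prop} {_ : DecidablePred P} (hP : ∀ j, P j ↔ h (S j).1 ≠ (S j).2)
    (hc : c < empErr S h) :
    c * m ≤ ((Finset.univ.filter P).card : ℝ) := by
  simp_rw [hP]
  rcases Nat.eq_zero_or_pos m with rfl | hm
  · simp
  · have : (0 : ℝ) < m := by exact_mod_cast hm
    exact ((lt_div_iff₀ this).1 hc).le

lemma empErr_impute_le {V : Set (Classifier X)} {h : Classifier X} (hh : h ∈ V) {m : ℕ}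
    (S : Fin m → LExample X) : empErr (fun j => impute V (S j)) h ≤ empErr S h := by
  refine div_le_div_of_nonneg_right (Nat.cast_le.2 (Finset.card_le_card fun j hj => ?_))
    (Nat.cast_nonneg _)
  simp only [Finset.mem_filter, Finset.mem_univ, true_and] at hj ⊢
  exact ne_of_ne_impute hh hj

lemma measurable_card_filter_cast {Ω : Type*} [MeasurableSpace Ω] {m : ℕ} {P : Fin m → Ω → Prop}
    [∀ ω, DecidablePred fun j => P j ω] (hP : ∀ j, MeasurableSet {ω | P j ω}) :
    Measurable fun ω => ((Finset.univ.filter fun j => P j ω).card : ℝ) := by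
  simp_rw [Finset.card_filter, Nat.cast_sum, Nat.cast_ite]
  exact Finset.measurable_sum _ fun j _ => Measurable.ite (hP j) measurable_const measurable_const

lemma measurable_empErr_of_measurable {Ω X : Type*} [MeasurableSpace Ω] [MeasurableSpace X] {m : ℕ}
    {h : Classifier X} (hh : Measurable h) {z : Ω → Fin m → LExample X}
    (hz : ∀ j, Measurable fun ω => z ω j) : Measurable fun ω => empErr (z ω) h :=
  (measurable_card_filter_cast (P := fun j ω => h (z ω j).1 ≠ (z ω j).2) fun j =>
    (measurableSet_eq_fun (hh.comp (hz j).fst) (hz j).snd).compl).div_const _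

end Impute

lemma phaseErr_pos (n : ℕ) : 0 < phaseErr n := by unfold phaseErr; positivity

lemma phaseErr_le_one (n : ℕ) : phaseErr n ≤ 1 := pow_le_one₀ (by norm_num) (by norm_num)

/-! ### Resampling the draws of one round -/

section Resampling

variable {X : Type*} {k : ℕ}

/-- Resampling of all slots of a round. -/
def replaceRound (n r : ℕ) (ω τ : Draws X k) : Draws X k := fun a =>
  if a.1 = n + 1 ∧ a.2.1 = r then τ a else ω a

/-- Resampling of the test examples of a round. -/
def replaceRoundTests (n r : ℕ) (ω : Draws X k) (τ : ℕ × ℕ × ℕ → Fin k → LExample X) : Draws X k :=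
  fun a => if a.1 = n + 1 ∧ a.2.1 = r then replaceTest (ω a, τ a) else ω a

lemma replaceRound_apply (n r j : ℕ) (ω τ : Draws X k) :
    replaceRound n r ω τ (n + 1, r, j) = τ (n + 1, r, j) := by simp [replaceRound]

lemma replaceRoundTests_apply (n r j : ℕ) (ω : Draws X k) (τ : ℕ × ℕ × ℕ → Fin k → LExample X) :
    replaceRoundTests n r ω τ (n + 1, r, j) = replaceTest (ω (n + 1, r, j), τ (n + 1, r, j)) := by
  simp [replaceRoundTests]

variable [MeasurableSpace X] (D : Fin k → Measure (LExample X))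
  [∀ i, IsProbabilityMeasure (D i)]

/-- An event is improbable if, for every choice of the draws of the other rounds, it is improbable
as an event about the slots of one round. -/
lemma drawLaw_le_of_replaceRound (n r m : ℕ) {E : Set (Draws X k)} (hE : MeasurableSet E)
    {p : ENNReal} (h : ∀ ω, ∃ B : Set (Fin m → Slot X k),
      (∀ τ, replaceRound n r ω τ ∈ E → (fun j : Fin m => τ (n + 1, r, j)) ∈ B) ∧
      Measure.pi (fun _ => slotLaw D) B ≤ p) : drawLaw D E ≤ p := by
  let rep : ℕ × ℕ × ℕ → Slot X k × Slot X k → Slot X k := fun a =>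
    if a.1 = n + 1 ∧ a.2.1 = r then Prod.snd else Prod.fst
  have hrep : ∀ a, MeasurePreserving (rep a) ((slotLaw D).prod (slotLaw D)) (slotLaw D) := by
    intro a
    by_cases ha : a.1 = n + 1 ∧ a.2.1 = r
    · simpa only [rep, if_pos ha] using measurePreserving_snd
    · simpa only [rep, if_neg ha] using measurePreserving_fst
  rw [drawLaw_eq]
  refine measure_le_of_resample _ _ hrep hE fun ω => ?_
  obtain ⟨B, hB, hp⟩ := h ω
  have hre : (fun (τ : Draws X k) a => rep a (ω a, τ a)) = replaceRound n r ω := by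
    funext τ a
    by_cases ha : a.1 = n + 1 ∧ a.2.1 = r <;> simp [rep, replaceRound, ha]
  have hmp := measurePreserving_reindex (slotLaw D) (fun j : Fin m => (n + 1, r, (j : ℕ)))
    fun a b hab => by simpa [Fin.ext_iff] using hab
  refine le_trans (measure_mono fun τ hτ => ?_)
    ((Measure.le_map_apply hmp.measurable.aemeasurable B).trans (hmp.map_eq ▸ hp))
  exact hB τ (by rw [← hre]; exact hτ)

/-- The same for the test examples of one round, with the rest of that round fixed, too. -/
lemma drawLaw_le_of_replaceRoundTests (n r m : ℕ) {E : Set (Draws X k)} (hE : MeasurableSet E)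
    {p : ENNReal} (h : ∀ ω, ∃ B : Set (Fin m → Fin k → LExample X),
      (∀ τ, replaceRoundTests n r ω τ ∈ E → (fun j : Fin m => τ (n + 1, r, j)) ∈ B) ∧
      Measure.pi (fun _ => Measure.pi D) B ≤ p) : drawLaw D E ≤ p := by
  let rep : ℕ × ℕ × ℕ → Slot X k × (Fin k → LExample X) → Slot X k := fun a =>
    if a.1 = n + 1 ∧ a.2.1 = r then replaceTest else Prod.fst
  have hrep : ∀ a, MeasurePreserving (rep a) ((slotLaw D).prod (Measure.pi D)) (slotLaw D) := by
    intro a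
    by_cases ha : a.1 = n + 1 ∧ a.2.1 = r
    · simpa only [rep, if_pos ha] using measurePreserving_replaceTest D
    · simpa only [rep, if_neg ha] using measurePreserving_fst
  rw [drawLaw_eq]
  refine measure_le_of_resample _ _ hrep hE fun ω => ?_
  obtain ⟨B, hB, hp⟩ := h ω
  have hre : (fun (τ : ℕ × ℕ × ℕ → Fin k → LExample X) a => rep a (ω a, τ a)) =
      replaceRoundTests n r ω := by
    funext τ a
    by_cases ha : a.1 = n + 1 ∧ a.2.1 = r <;> simp [rep, replaceRoundTests, ha]
  have hmp := measurePreserving_reindex (Measure.pi D) (fun j : Fin m => (n + 1, r, (j : ℕ)))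
    fun a b hab => by simpa [Fin.ext_iff] using hab
  refine le_trans (measure_mono fun τ hτ => ?_)
    ((Measure.le_map_apply hmp.measurable.aemeasurable B).trans (hmp.map_eq ▸ hp))
  exact hB τ (by rw [← hre]; exact hτ)

end Resampling

/-! ### The run of the algorithm as a function of the random draws -/

/-- The weights of a round depend on the slots of the earlier rounds only. -/
lemma weights_congr {X : Type*} {k : ℕ} [NeZero k] (κ : PassiveConstants) (erm : Rule X) (d : ℕ)
    (V : Set (Classifier X)) (ζ δ' : ℝ) {s s' : ℕ → ℕ → Slot X k} (r : ℕ)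
    (h : ∀ r' < r, s r' = s' r') :
    weights κ erm d V ζ δ' s r = weights κ erm d V ζ δ' s' r := by
  induction r with
  | zero => rfl
  | succ r ih =>
    funext i
    simp only [weights]
    rw [ih fun r' hr' => h r' (hr'.trans r.lt_succ_self), h r r.lt_succ_self]

section Run

variable {X : Type*} [MeasurableSpace X] {k : ℕ} [NeZero k]
variable (κ : PassiveConstants) (erm : Rule X) (D : Fin k → Measure (LExample X))
  (H : Set (Classifier X)) (d : ℕ) (δ : ℝ)

/-- The version space with which phase `n + 1` begins. -/
local notation "𝒱" => versionSpace κ erm D H d δ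

/-- The minimizer learned in round `r` of phase `n + 1`. -/
noncomputable def phaseClassifier (n r : ℕ) (ω : Draws X k) : Classifier X :=
  roundClassifier κ erm d (𝒱 ω n) (phaseErr (n + 1)) (phaseConf δ (n + 1)) (phaseDraws ω (n + 1)) r

/-- The weights at the start of round `r` of phase `n + 1`. -/
noncomputable def phaseWeights (n r : ℕ) (ω : Draws X k) : Fin k → ℝ :=
  weights κ erm d (𝒱 ω n) (phaseErr (n + 1)) (phaseConf δ (n + 1)) (phaseDraws ω (n + 1)) r

/-- Whether the classifier of round `r` of phase `n + 1` passes the test on distribution `i`. -/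
def PhaseAccepts (n r : ℕ) (i : Fin k) (ω : Draws X k) : Prop :=
  accepts κ (𝒱 ω n) (phaseErr (n + 1)) (phaseConf δ (n + 1))
    (phaseClassifier κ erm D H d δ n r ω) (phaseDraws ω (n + 1) r) i

/-- The classifier of a round. -/
local notation "𝒻" => phaseClassifier κ erm D H d δ

/-- The weights of a round. -/
local notation "𝒶" => phaseWeights κ erm D H d δ

/-- The size of the mixture sample of a round of phase `n + 1`. -/
local notation "𝓂" => fun n : ℕ => mixSize κ k d (phaseErr (n + 1)) (phaseConf δ (n + 1))

/-- The size of the test samples of a round of phase `n + 1`. -/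
local notation "𝓉" => fun n : ℕ => testSize κ k (phaseErr (n + 1)) (phaseConf δ (n + 1))

lemma phaseClassifier_eq (n r : ℕ) (ω : Draws X k) :
    𝒻 n r ω = erm (𝒱 ω n) (mixSize κ k d (phaseErr (n + 1)) (phaseConf δ (n + 1)))
      fun j => impute (𝒱 ω n) (mixDraw (𝒶 n r ω) (ω (n + 1, r, j))) := rfl

lemma phaseWeights_succ (n r : ℕ) (ω : Draws X k) (i : Fin k) :
    𝒶 n (r + 1) ω i = if PhaseAccepts κ erm D H d δ n r i ω then 𝒶 n r ω i
      else κ.boost * 𝒶 n r ω i := rfl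

lemma phaseWeights_pos (n r : ℕ) (ω : Draws X k) (i : Fin k) : 0 < 𝒶 n r ω i := by
  induction r with
  | zero => exact one_pos
  | succ r ih =>
    rw [phaseWeights_succ]
    split_ifs
    · exact ih
    · exact mul_pos (one_pos.trans κ.one_lt_boost) ih

/-- The version space with which phase `n + 1` begins depends on the draws of the first `n` phases
only. -/
lemma versionSpace_congr {ω ω' : Draws X k} (n : ℕ)
    (h : ∀ m r j, m ≤ n → ω (m, r, j) = ω' (m, r, j)) : 𝒱 ω n = 𝒱 ω' n := by
  induction n with
  | zero => rfl
  | succ n ih =>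
    have h1 : phaseDraws ω (n + 1) = phaseDraws ω' (n + 1) := by
      funext r j; exact h _ _ _ le_rfl
    simp only [versionSpace]
    rw [ih fun m r j hm => h m r j (hm.trans n.le_succ), h1]

lemma versionSpace_subset (ω : Draws X k) (n : ℕ) :
    𝒱 ω n ⊆ H := by
  induction n with
  | zero => exact subset_rfl
  | succ n ih => exact fun h hh => ih hh.1

lemma phaseWeights_congr {ω ω' : Draws X k} (n r : ℕ)
    (h : ∀ m r' j, m ≤ n ∨ (m = n + 1 ∧ r' < r) → ω (m, r', j) = ω' (m, r', j)) :
    𝒶 n r ω = 𝒶 n r ω' := by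
  unfold phaseWeights
  rw [versionSpace_congr κ erm D H d δ n fun m r' j hm => h m r' j (Or.inl hm)]
  refine weights_congr κ erm d _ _ _ r fun r' hr' => ?_
  funext j
  exact h _ _ _ (Or.inr ⟨rfl, hr'⟩)

/-! ### Measurability of the run -/

section Measurability

variable {κ erm D H d δ} {ε : ℝ} (hrun : MeasurableRun κ erm D H d ε δ)
include hrun

lemma measurableSet_mem_DIS {n : ℕ} (hn : n < numPhases ε) :
    MeasurableSet {p : Draws X k × X | p.2 ∈ DIS (𝒱 p.1 n)} := by
  simp_rw [mem_DIS_iff]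
  exact (hrun.predictions n hn true).inter (hrun.predictions n hn false)

lemma measurable_impute {n : ℕ} (hn : n < numPhases ε) :
    Measurable fun p : Draws X k × LExample X => impute (𝒱 p.1 n) p.2 := by
  have hf : Measurable fun p : Draws X k × LExample X => (p.1, p.2.1) := by fun_prop
  refine Measurable.prodMk (by fun_prop) (Measurable.ite
    ((measurableSet_mem_DIS hrun hn).preimage hf) (by fun_prop) ?_)
  exact measurable_to_bool (by
    simpa [Set.preimage] using (hrun.predictions n hn true).preimage hf)

lemma measurableSet_versionSpace_nonempty {n : ℕ} (hn : n < numPhases ε) (x : X) :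
    MeasurableSet {ω : Draws X k | (𝒱 ω n).Nonempty} := by
  have h := fun b => (hrun.predictions n hn b).preimage
    (f := fun ω : Draws X k => (ω, x)) (by fun_prop)
  convert (h true).union (h false) using 1
  ext ω
  simp only [mem_ofPred_eq, mem_union, mem_preimage]
  constructor
  · rintro ⟨h, hh⟩
    cases e : h x
    · exact Or.inr ⟨h, hh, e⟩
    · exact Or.inl ⟨h, hh, e⟩
  · rintro (⟨h, hh, -⟩ | ⟨h, hh, -⟩) <;> exact ⟨h, hh⟩

lemma measurableSet_loss {n r : ℕ} (hn : n < numPhases ε) (hr : r < numRounds κ k) :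
    MeasurableSet {p : Draws X k × LExample X | 𝒻 n r p.1 p.2.1 ≠ (impute (𝒱 p.1 n) p.2).2} := by
  have h1 : Measurable fun p : Draws X k × LExample X => 𝒻 n r p.1 p.2.1 :=
    (hrun.classifiers n hn r hr).comp (f := fun p : Draws X k × LExample X => (p.1, p.2.1))
      (by fun_prop)
  exact (measurableSet_eq_fun h1 (measurable_impute hrun hn).snd).compl

lemma measurable_empErr {n r : ℕ} (hn : n < numPhases ε) (hr : r < numRounds κ k) {m : ℕ}
    {z : Fin m → Draws X k → LExample X} (hz : ∀ j, Measurable (z j)) :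
    Measurable fun ω => empErr (fun j => impute (𝒱 ω n) (z j ω)) (𝒻 n r ω) := by
  unfold empErr
  simp_rw [Finset.card_filter, Nat.cast_sum, Nat.cast_ite]
  refine (Finset.measurable_sum _ fun j _ => Measurable.ite ?_ measurable_const
    measurable_const).div_const _
  exact (measurableSet_loss hrun hn hr).preimage (f := fun ω => (ω, z j ω))
    (measurable_id.prodMk (hz j))

lemma measurable_imputedErr [∀ i, IsProbabilityMeasure (D i)] {n r : ℕ} (hn : n < numPhases ε)
    (hr : r < numRounds κ k) (i : Fin k) :
    Measurable fun ω => imputedErr (D i) (𝒱 ω n) (𝒻 n r ω) :=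
  (measurable_measure_prodMk_left (ν := D i) (measurableSet_loss hrun hn hr)).ennreal_toReal

lemma measurableSet_phaseAccepts {n r : ℕ} (hn : n < numPhases ε) (hr : r < numRounds κ k)
    (i : Fin k) : MeasurableSet {ω | PhaseAccepts κ erm D H d δ n r i ω} := by
  refine measurableSet_le (measurable_empErr hrun hn hr fun j => ?_) measurable_const
  simp only [phaseDraws, Slot.test]
  fun_prop

lemma measurable_phaseWeights {n r : ℕ} (hn : n < numPhases ε) (hr : r ≤ numRounds κ k) :
    Measurable (𝒶 n r) := by
  induction r with
  | zero => exact measurable_const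
  | succ r ih =>
    have ih' := ih (Nat.le_of_succ_le hr)
    refine measurable_pi_lambda _ fun i => ?_
    simp_rw [phaseWeights_succ]
    exact Measurable.ite (measurableSet_phaseAccepts hrun hn hr i) (by fun_prop) (by fun_prop)

lemma measurable_measureReal_DIS [∀ i, IsProbabilityMeasure (D i)] {n : ℕ} (hn : n < numPhases ε)
    (i : Fin k) :
    Measurable fun ω => (D i).real {z | z.1 ∈ DIS (𝒱 ω n)} := by
  have h : MeasurableSet {p : Draws X k × LExample X | p.2.1 ∈ DIS (𝒱 p.1 n)} :=
    (measurableSet_mem_DIS hrun hn).preimage (f := fun p : Draws X k × LExample X => (p.1, p.2.1))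
      (by fun_prop)
  exact (measurable_measure_prodMk_left (ν := D i) h).ennreal_toReal

end Measurability

/-! ### The bad events of a round -/

/-- The examples drawn from the mixture in a round, with their true labels. -/
noncomputable def rawSample (n r m : ℕ) (ω : Draws X k) : Fin m → LExample X :=
  fun j => mixDraw (𝒶 n r ω) (ω (n + 1, r, j))

/-- The optimal classifier errs too often on the mixture sample of the round. -/
def BadOptimum (hstar : Classifier X) (n r : ℕ) : Set (Draws X k) :=
  {ω | 0.085 * phaseErr (n + 1) < empErr (rawSample κ erm D H d δ n r (𝓂 n) ω) hstar}

/-- The minimizer of the round has a small empirical error on the imputed mixture sample, but a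
large error for the imputed mixture. -/
def BadMinimizer (n r : ℕ) : Set (Draws X k) :=
  {ω | (𝒱 ω n).Nonempty ∧
    empErr (fun j => impute (𝒱 ω n) (rawSample κ erm D H d δ n r (𝓂 n) ω j)) (𝒻 n r ω) ≤
      0.085 * phaseErr (n + 1) ∧
    0.1 * phaseErr (n + 1) * ∑ i, 𝒶 n r ω i <
      ∑ i, 𝒶 n r ω i * imputedErr (D i) (𝒱 ω n) (𝒻 n r ω)}

/-- The test of the round misjudges its minimizer on distribution `i`. -/
def BadTest (n r : ℕ) (i : Fin k) : Set (Draws X k) :=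
  {ω | (PhaseAccepts κ erm D H d δ n r i ω ∧
      0.64 * phaseErr (n + 1) ≤ imputedErr (D i) (𝒱 ω n) (𝒻 n r ω)) ∨
    (¬ PhaseAccepts κ erm D H d δ n r i ω ∧
      imputedErr (D i) (𝒱 ω n) (𝒻 n r ω) ≤ 0.6 * phaseErr (n + 1))}

/-- The disagreement region has probability at most `q`, but far more examples of the mixture sample
than expected fall into it. -/
def BadMixQueries (q y : ℝ) (n r : ℕ) : Set (Draws X k) :=
  {ω | (∀ i, (D i).real {z | z.1 ∈ DIS (𝒱 ω n)} ≤ q) ∧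
    2 * (𝓂 n : ℝ) * q + y ≤ (Finset.univ.filter fun j : Fin (𝓂 n) =>
      (rawSample κ erm D H d δ n r (𝓂 n) ω j).1 ∈ DIS (𝒱 ω n)).card}

/-- The disagreement region has probability at most `q`, but far more test examples than expected
fall into it. -/
def BadTestQueries (q y : ℝ) (n r : ℕ) : Set (Draws X k) :=
  {ω | (∀ i, (D i).real {z | z.1 ∈ DIS (𝒱 ω n)} ≤ q) ∧
    2 * k * (𝓉 n : ℝ) * q + y ≤ ∑ i, ((Finset.univ.filter fun j : Fin (𝓉 n) =>
      ((ω (n + 1, r, j)).test i).1 ∈ DIS (𝒱 ω n)).card : ℝ)}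

section Measurability

variable {κ erm D H d δ} {ε : ℝ} (hrun : MeasurableRun κ erm D H d ε δ)
include hrun

lemma measurable_rawSample {n r : ℕ} (hn : n < numPhases ε) (hr : r < numRounds κ k) (m : ℕ)
    (j : Fin m) : Measurable fun ω => rawSample κ erm D H d δ n r m ω j :=
  measurable_mixDraw.comp ((measurable_phaseWeights hrun hn hr.le).prodMk (by fun_prop))

lemma measurableSet_badOptimum {hstar : Classifier X} (hh : Measurable hstar) {n r : ℕ}
    (hn : n < numPhases ε) (hr : r < numRounds κ k) :
    MeasurableSet (BadOptimum κ erm D H d δ hstar n r) :=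
  measurableSet_lt measurable_const
    (measurable_empErr_of_measurable hh fun j => measurable_rawSample hrun hn hr _ j)

variable [∀ i, IsProbabilityMeasure (D i)]

lemma measurableSet_badMinimizer (x : X) {n r : ℕ} (hn : n < numPhases ε)
    (hr : r < numRounds κ k) : MeasurableSet (BadMinimizer κ erm D H d δ n r) := by
  have hw : ∀ i, Measurable fun ω => 𝒶 n r ω i := fun i =>
    (measurable_pi_apply i).comp (measurable_phaseWeights hrun hn hr.le)
  have h1 : Measurable fun ω => 0.1 * phaseErr (n + 1) * ∑ i, 𝒶 n r ω i :=
    (Finset.measurable_sum _ fun i _ => hw i).const_mul _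
  have h2 : Measurable fun ω => ∑ i, 𝒶 n r ω i * imputedErr (D i) (𝒱 ω n) (𝒻 n r ω) :=
    Finset.measurable_sum _ fun i _ => (hw i).mul (measurable_imputedErr hrun hn hr i)
  exact (measurableSet_versionSpace_nonempty hrun hn x).inter ((measurableSet_le
    (measurable_empErr hrun hn hr fun j => measurable_rawSample hrun hn hr _ j)
    measurable_const).inter (measurableSet_lt h1 h2))

lemma measurableSet_badTest {n r : ℕ} (hn : n < numPhases ε) (hr : r < numRounds κ k)
    (i : Fin k) : MeasurableSet (BadTest κ erm D H d δ n r i) := by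
  have hA := measurableSet_phaseAccepts hrun hn hr i
  have hE := measurable_imputedErr hrun hn hr i
  exact (hA.inter (measurableSet_le measurable_const hE)).union
    (hA.compl.inter (measurableSet_le hE measurable_const))

lemma measurableSet_forall_measureReal_DIS_le (q : ℝ) {n : ℕ} (hn : n < numPhases ε) :
    MeasurableSet {ω | ∀ i, (D i).real {z | z.1 ∈ DIS (𝒱 ω n)} ≤ q} := by
  rw [Set.ofPred_forall]
  exact MeasurableSet.iInter fun i =>
    measurableSet_le (measurable_measureReal_DIS hrun hn i) measurable_const

lemma measurableSet_badMixQueries (q y : ℝ) {n r : ℕ} (hn : n < numPhases ε)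
    (hr : r < numRounds κ k) : MeasurableSet (BadMixQueries κ erm D H d δ q y n r) := by
  refine (measurableSet_forall_measureReal_DIS_le hrun q hn).inter
    (measurableSet_le measurable_const (measurable_card_filter_cast fun j => ?_))
  exact (measurableSet_mem_DIS hrun hn).preimage
    (measurable_id.prodMk (measurable_rawSample hrun hn hr _ j).fst)

lemma measurableSet_badTestQueries (q y : ℝ) {n : ℕ} (r : ℕ) (hn : n < numPhases ε) :
    MeasurableSet (BadTestQueries κ erm D H d δ q y n r) := by
  refine (measurableSet_forall_measureReal_DIS_le hrun q hn).inter
    (measurableSet_le measurable_const (Finset.measurable_sum _ fun i _ =>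
      measurable_card_filter_cast fun j => ?_))
  refine (measurableSet_mem_DIS hrun hn).preimage
    (f := fun ω : Draws X k => (ω, ((ω (n + 1, r, j)).test i).1)) ?_
  simp only [Slot.test]
  fun_prop

end Measurability

/-! ### Probabilities of the bad events -/

/-! The version space and the weights of a round are determined before its draws, and its minimizer
before its tests; resampling leaves them unchanged. -/

lemma versionSpace_replaceRound (n r : ℕ) (ω τ : Draws X k) :
    𝒱 (replaceRound n r ω τ) n = 𝒱 ω n :=
  versionSpace_congr κ erm D H d δ n fun m r' j hm => by
    simp [replaceRound, show m ≠ n + 1 by omega]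

lemma phaseWeights_replaceRound (n r : ℕ) (ω τ : Draws X k) :
    𝒶 n r (replaceRound n r ω τ) = 𝒶 n r ω :=
  phaseWeights_congr κ erm D H d δ n r fun m r' j hm => by
    have : ¬ (m = n + 1 ∧ r' = r) := by omega
    simp only [replaceRound, if_neg this]

lemma versionSpace_replaceRoundTests (n r : ℕ) (ω : Draws X k)
    (τ : ℕ × ℕ × ℕ → Fin k → LExample X) :
    𝒱 (replaceRoundTests n r ω τ) n = 𝒱 ω n :=
  versionSpace_congr κ erm D H d δ n fun m r' j hm => by
    simp [replaceRoundTests, show m ≠ n + 1 by omega]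

lemma phaseWeights_replaceRoundTests (n r : ℕ) (ω : Draws X k)
    (τ : ℕ × ℕ × ℕ → Fin k → LExample X) :
    𝒶 n r (replaceRoundTests n r ω τ) = 𝒶 n r ω :=
  phaseWeights_congr κ erm D H d δ n r fun m r' j hm => by
    have : ¬ (m = n + 1 ∧ r' = r) := by omega
    simp only [replaceRoundTests, if_neg this]

lemma phaseClassifier_replaceRoundTests (n r : ℕ) (ω : Draws X k)
    (τ : ℕ × ℕ × ℕ → Fin k → LExample X) :
    𝒻 n r (replaceRoundTests n r ω τ) = 𝒻 n r ω := by
  rw [phaseClassifier_eq, phaseClassifier_eq, versionSpace_replaceRoundTests,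
    phaseWeights_replaceRoundTests]
  congr 1
  funext j
  rw [replaceRoundTests_apply]
  rfl

lemma rawSample_replaceRound (n r m : ℕ) (ω τ : Draws X k) :
    rawSample κ erm D H d δ n r m (replaceRound n r ω τ) =
      fun j : Fin m => mixDraw (𝒶 n r ω) (τ (n + 1, r, j)) := by
  funext j
  rw [rawSample, phaseWeights_replaceRound, replaceRound_apply]

lemma phaseClassifier_replaceRound (n r : ℕ) (ω τ : Draws X k) :
    𝒻 n r (replaceRound n r ω τ) = erm (𝒱 ω n) (𝓂 n)
      fun j => impute (𝒱 ω n) (mixDraw (𝒶 n r ω) (τ (n + 1, r, j))) := by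
  rw [phaseClassifier_eq, versionSpace_replaceRound, phaseWeights_replaceRound]
  congr 1
  funext j
  rw [replaceRound_apply]

section Bounds

variable {κ erm D H d δ} {ε : ℝ} [∀ i, IsProbabilityMeasure (D i)]
  (hrun : MeasurableRun κ erm D H d ε δ)
include hrun

/-- At rate `1 / 32` the exponential moment gives the exponent
`(0.08 * (e ^ (1 / 32) - 1) - 0.085 / 32) ζ m ≤ -0.00007 ζ m`. -/
lemma drawLaw_badOptimum_le {hstar : Classifier X} (hh : Measurable hstar) {n r : ℕ}
    (hn : n < numPhases ε) (hr : r < numRounds κ k)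
    (hopt : ∀ i, err (D i) hstar ≤ 0.08 * phaseErr (n + 1)) :
    drawLaw D (BadOptimum κ erm D H d δ hstar n r) ≤
      ENNReal.ofReal (Real.exp (-(0.00007 * (phaseErr (n + 1) * 𝓂 n)))) := by
  refine drawLaw_le_of_replaceRound D n r (𝓂 n) (measurableSet_badOptimum hrun hh hn hr) fun ω => ?_
  set ζ := phaseErr (n + 1) with hζ
  have hζ0 : 0 < ζ := phaseErr_pos _
  set m := mixSize κ k d ζ (phaseConf δ (n + 1)) with hm
  have hA : MeasurableSet {z : LExample X | hstar z.1 ≠ z.2} :=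
    (measurableSet_eq_fun (hh.comp measurable_fst) measurable_snd).compl
  refine ⟨_, fun τ hτ => ?_, (measure_pi_card_ge_le (slotLaw D)
    (A := {s | mixDraw (𝒶 n r ω) s ∈ {z : LExample X | hstar z.1 ≠ z.2}})
    (hA.preimage (measurable_mixDraw_right _))
    (measureReal_mixDraw_le D (𝒶 n r ω) hA hopt) (a := 1 / 32) (by norm_num) m
    (0.085 * ζ * m)).trans ?_⟩
  · have h1 : 0.085 * ζ < empErr (rawSample κ erm D H d δ n r m (replaceRound n r ω τ)) hstar := hτ
    rw [rawSample_replaceRound] at h1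
    exact le_card_of_lt_empErr (fun _ => Iff.rfl) h1
  · refine ENNReal.ofReal_le_ofReal (Real.exp_le_exp.2 ?_)
    have he := exp_le_one_add_add_sq (a := 1 / 32) (by rw [abs_of_pos] <;> norm_num)
    have hζm : 0 ≤ ζ * m := by positivity
    nlinarith [mul_le_mul_of_nonneg_left he hζm]

/-- Exponential moments at rate `± 1 / 60`; the relative gap between the threshold of the test and
the two error levels is about `1 / 30`. -/
lemma drawLaw_badTest_le (htol : κ.tol = 0.62) {n r : ℕ} (hn : n < numPhases ε)
    (hr : r < numRounds κ k) (i : Fin k) :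
    drawLaw D (BadTest κ erm D H d δ n r i) ≤
      ENNReal.ofReal (Real.exp (-(0.00015 * (phaseErr (n + 1) * 𝓉 n)))) := by
  refine drawLaw_le_of_replaceRoundTests D n r (𝓉 n) (measurableSet_badTest hrun hn hr i)
    fun ω => ?_
  set ζ := phaseErr (n + 1) with hζ
  have hζ0 : 0 < ζ := phaseErr_pos _
  set m := testSize κ k ζ (phaseConf δ (n + 1)) with hm
  let A : Set (LExample X) := {z | 𝒻 n r ω z.1 ≠ (impute (𝒱 ω n) z).2}
  have hA : MeasurableSet A :=
    (measurableSet_loss hrun hn hr).preimage (f := fun z => (ω, z)) (by fun_prop)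
  have hA' : MeasurableSet {t : Fin k → LExample X | t i ∈ A} := hA.preimage (measurable_pi_apply i)
  have hlaw : (Measure.pi D).real {t : Fin k → LExample X | t i ∈ A} =
      imputedErr (D i) (𝒱 ω n) (𝒻 n r ω) :=
    congrArg ENNReal.toReal
      ((measurePreserving_eval D i).measure_preimage hA.nullMeasurableSet)
  have hζm : 0 ≤ ζ * m := by positivity
  have hacc : ∀ τ, PhaseAccepts κ erm D H d δ n r i (replaceRoundTests n r ω τ) ↔
      empErr (fun j : Fin m => impute (𝒱 ω n) (τ (n + 1, r, j) i)) (𝒻 n r ω) ≤ 0.62 * ζ := by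
    intro τ
    rw [PhaseAccepts, phaseClassifier_replaceRoundTests, versionSpace_replaceRoundTests, accepts,
      htol]
    simp only [phaseDraws, replaceRoundTests_apply]
    rfl
  -- The classifier is fixed before the test, so that only one of the two failures can happen.
  rcases le_total (imputedErr (D i) (𝒱 ω n) (𝒻 n r ω)) (0.62 * ζ) with hle | hle
  · by_cases h6 : imputedErr (D i) (𝒱 ω n) (𝒻 n r ω) ≤ 0.6 * ζ
    · refine ⟨_, fun τ hτ => ?_, (measure_pi_card_ge_le (Measure.pi D) hA' (hlaw.trans_le h6)
        (a := 1 / 60) (by norm_num) m (0.62 * ζ * m)).trans ?_⟩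
      · rw [BadTest, mem_ofPred_eq, hacc, phaseClassifier_replaceRoundTests,
          versionSpace_replaceRoundTests] at hτ
        rcases hτ with ⟨-, h⟩ | ⟨h, -⟩
        · exfalso; linarith
        · exact le_card_of_lt_empErr (fun _ => Iff.rfl) (not_le.1 h)
      · refine ENNReal.ofReal_le_ofReal (Real.exp_le_exp.2 ?_)
        have he := exp_le_one_add_add_sq (a := 1 / 60) (by rw [abs_of_pos] <;> norm_num)
        nlinarith [mul_le_mul_of_nonneg_left he hζm]
    · refine ⟨∅, fun τ hτ => ?_, by simp⟩
      rw [BadTest, mem_ofPred_eq, hacc, phaseClassifier_replaceRoundTests,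
          versionSpace_replaceRoundTests] at hτ
      rcases hτ with ⟨-, h⟩ | ⟨-, h⟩
      · exfalso; linarith
      · exact absurd h h6
  · by_cases h6 : 0.64 * ζ ≤ imputedErr (D i) (𝒱 ω n) (𝒻 n r ω)
    · refine ⟨_, fun τ hτ => ?_, (measure_pi_card_le_le (Measure.pi D) hA' (h6.trans_eq hlaw.symm)
        (a := 1 / 60) (by norm_num) m (0.62 * ζ * m)).trans ?_⟩
      · rw [BadTest, mem_ofPred_eq, hacc, phaseClassifier_replaceRoundTests,
          versionSpace_replaceRoundTests] at hτ
        rcases hτ with ⟨h, -⟩ | ⟨-, h⟩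
        · exact card_le_of_empErr_le (fun _ => Iff.rfl) h
        · exfalso; linarith
      · refine ENNReal.ofReal_le_ofReal (Real.exp_le_exp.2 ?_)
        have he := exp_le_one_add_add_sq (a := -(1 / 60)) (by rw [abs_neg, abs_of_pos] <;> norm_num)
        nlinarith [mul_le_mul_of_nonneg_left he hζm]
    · refine ⟨∅, fun τ hτ => ?_, by simp⟩
      rw [BadTest, mem_ofPred_eq, hacc, phaseClassifier_replaceRoundTests,
          versionSpace_replaceRoundTests] at hτ
      rcases hτ with ⟨-, h⟩ | ⟨-, h⟩
      · exact absurd h h6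
      · exfalso; linarith

lemma drawLaw_badMixQueries_le {q : ℝ} (hq : 0 ≤ q) (y : ℝ) {n r : ℕ} (hn : n < numPhases ε)
    (hr : r < numRounds κ k) :
    drawLaw D (BadMixQueries κ erm D H d δ q y n r) ≤ ENNReal.ofReal (Real.exp (-y)) := by
  refine drawLaw_le_of_replaceRound D n r (𝓂 n) (measurableSet_badMixQueries hrun q y hn hr)
    fun ω => ?_
  set m := mixSize κ k d (phaseErr (n + 1)) (phaseConf δ (n + 1)) with hm
  let A : Set (LExample X) := {z | z.1 ∈ DIS (𝒱 ω n)}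
  have hA : MeasurableSet A :=
    (measurableSet_mem_DIS hrun hn).preimage (f := fun z : LExample X => (ω, z.1)) (by fun_prop)
  by_cases hp : ∀ i, (D i).real A ≤ q
  · refine ⟨_, fun τ hτ => ?_, (measure_pi_card_ge_le (slotLaw D)
      (A := {s | mixDraw (𝒶 n r ω) s ∈ A}) (hA.preimage (measurable_mixDraw_right _))
      (measureReal_mixDraw_le D (𝒶 n r ω) hA hp) one_pos m (2 * m * q + y)).trans ?_⟩
    · have h1 := hτ.2
      rw [rawSample_replaceRound, versionSpace_replaceRound] at h1
      exact h1
    · refine ENNReal.ofReal_le_ofReal (Real.exp_le_exp.2 ?_)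
      have he : Real.exp 1 ≤ 3 := by linarith [Real.exp_one_lt_d9]
      have hmq : 0 ≤ m * q := by positivity
      nlinarith [mul_le_mul_of_nonneg_left he hmq]
  · refine ⟨∅, fun τ hτ => hp ?_, by simp⟩
    have h1 := hτ.1
    rw [versionSpace_replaceRound] at h1
    exact h1

lemma drawLaw_badTestQueries_le (q y : ℝ) {n : ℕ} (r : ℕ) (hn : n < numPhases ε) :
    drawLaw D (BadTestQueries κ erm D H d δ q y n r) ≤ ENNReal.ofReal (Real.exp (-y)) := by
  refine drawLaw_le_of_replaceRoundTests D n r (𝓉 n) (measurableSet_badTestQueries hrun q y r hn)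
    fun ω => ?_
  set m := testSize κ k (phaseErr (n + 1)) (phaseConf δ (n + 1)) with hm
  let A : Set (LExample X) := {z | z.1 ∈ DIS (𝒱 ω n)}
  have hA : MeasurableSet A :=
    (measurableSet_mem_DIS hrun hn).preimage (f := fun z : LExample X => (ω, z.1)) (by fun_prop)
  by_cases hp : ∀ i, (D i).real A ≤ q
  · refine ⟨_, fun τ hτ => ?_,
      (measure_pi_sum_card_ge_le D hA hp m (2 * k * m * q + y)).trans ?_⟩
    · have h1 := hτ.2
      rw [versionSpace_replaceRoundTests] at h1
      simp only [replaceRoundTests_apply] at h1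
      exact h1
    · refine ENNReal.ofReal_le_ofReal (Real.exp_le_exp.2 (le_of_eq ?_))
      ring
  · refine ⟨∅, fun τ hτ => hp ?_, by simp⟩
    have h1 := hτ.1
    rw [versionSpace_replaceRoundTests] at h1
    exact h1

/-- The growth function is at most polynomial in `1 / ζ`, so that it is beaten by the exponential
bound for a single labelling. -/
lemma drawLaw_badMinimizer_le (herm : IsERM erm) (hd : vcDim H = d) (x : X) {n r : ℕ}
    (hn : n < numPhases ε) (hr : r < numRounds κ k) :
    drawLaw D (BadMinimizer κ erm D H d δ n r) ≤
      ENNReal.ofReal (Real.exp (15 * (d * Real.log (2 / phaseErr (n + 1))) -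
        0.000175 * (phaseErr (n + 1) * 𝓂 n))) := by
  refine drawLaw_le_of_replaceRound D n r (𝓂 n) (measurableSet_badMinimizer hrun x hn hr)
    fun ω => ?_
  set ζ := phaseErr (n + 1) with hζ
  have hζ0 : 0 < ζ := phaseErr_pos _
  have hζ1 : ζ ≤ 1 := phaseErr_le_one _
  set m := mixSize κ k d ζ (phaseConf δ (n + 1)) with hm
  -- The minimizer belongs to the class only if the version space is nonempty.
  by_cases hV : (𝒱 ω n).Nonempty
  swap
  · refine ⟨∅, fun τ hτ => hV ?_, by simp⟩
    have h1 := hτ.1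
    rwa [versionSpace_replaceRound] at h1
  let Z : Slot X k → LExample X := fun s => impute (𝒱 ω n) (mixDraw (𝒶 n r ω) s)
  let G : (Fin m → Slot X k) → Classifier X := fun s => erm (𝒱 ω n) m fun j => Z (s j)
  have hG : ∀ s, G s ∈ H := fun s => versionSpace_subset κ erm D H d δ ω n (herm _ hV _ _).1
  -- The run in which the slots of the round are the given ones.
  let ext : (Fin m → Slot X k) → Draws X k := fun s a =>
    if h : (a.1 = n + 1 ∧ a.2.1 = r) ∧ a.2.2 < m then s ⟨a.2.2, h.2⟩ else ω a
  have hext : Measurable ext := by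
    refine measurable_pi_lambda _ fun a => ?_
    by_cases h : (a.1 = n + 1 ∧ a.2.1 = r) ∧ a.2.2 < m
    · simp only [ext, dif_pos h]; fun_prop
    · simp only [ext, dif_neg h]; fun_prop
  have hextr : ∀ s, ext s = replaceRound n r ω (ext s) := by
    intro s
    funext a
    by_cases h : a.1 = n + 1 ∧ a.2.1 = r <;> simp [ext, replaceRound, h]
  have hextG : ∀ s, 𝒻 n r (ext s) = G s := by
    intro s
    rw [hextr, phaseClassifier_replaceRound]
    simp only [G, Z]
    congr 1
    funext j
    have hj : (j : ℕ) < m := j.2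
    simp [ext, hj]
  have hextV : ∀ s, 𝒱 (ext s) n = 𝒱 ω n := fun s => by
    rw [hextr, versionSpace_replaceRound]
  have hM : MeasurableSet {p : (Fin m → Slot X k) × Slot X k | G p.1 (Z p.2).1 ≠ (Z p.2).2} := by
    have h1 := (measurableSet_loss hrun hn hr).preimage
      (f := fun p : (Fin m → Slot X k) × Slot X k => (ext p.1, mixDraw (𝒶 n r ω) p.2))
      ((hext.comp measurable_fst).prodMk ((measurable_mixDraw_right _).comp measurable_snd))
    refine (congrArg MeasurableSet ?_).mp h1
    ext p
    simp only [mem_preimage, mem_ofPred_eq, hextG, hextV]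
    rfl
  have hlossm : ∀ s, MeasurableSet {z : LExample X | G s z.1 ≠ (impute (𝒱 ω n) z).2} := by
    intro s
    have h1 := (measurableSet_loss hrun hn hr).preimage
      (f := fun z : LExample X => (ext s, z)) (by fun_prop)
    refine (congrArg MeasurableSet ?_).mp h1
    ext z
    simp only [mem_preimage, mem_ofPred_eq, hextG, hextV]
  refine ⟨_, fun τ hτ => ?_, (measure_pi_learned_le hd (slotLaw D) Z G hG hM
    (u := 0.085 * ζ * m) (v := 0.1 * ζ) (by positivity)).trans ?_⟩
  · obtain ⟨-, h1, h2⟩ := hτ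
    rw [rawSample_replaceRound, phaseClassifier_replaceRound, versionSpace_replaceRound] at h1
    rw [phaseWeights_replaceRound, phaseClassifier_replaceRound, versionSpace_replaceRound] at h2
    refine ⟨card_le_of_empErr_le (fun _ => Iff.rfl) h1, ?_⟩
    have hα := phaseWeights_pos κ erm D H d δ n r ω
    have hW : 0 < ∑ i, 𝒶 n r ω i := Finset.sum_pos (fun i _ => hα i) Finset.univ_nonempty
    exact ((le_div_iff₀ hW).2 h2.le).trans (le_measureReal_mixDraw D hα (hlossm _))
  · refine ENNReal.ofReal_le_ofReal ?_
    -- With `t = ζ / 20000` the exponential factor `e ^ (2 t m)` of the growth function costs less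
    -- than the gain `(0.00495 - 0.055 * 0.085) ζ m`.
    have hN := sum_choose_le (d := d) (N := 2 * m) (t := ζ / 20000) (by positivity) (by linarith)
    have hpoly : (1 / (ζ / 20000)) ^ d ≤ Real.exp (15 * (d * Real.log (2 / ζ))) := by
      have h1 : 1 / (ζ / 20000) ≤ (2 / ζ) ^ 15 := by
        rw [div_pow, one_div_div, div_le_div_iff₀ hζ0 (by positivity)]
        have : ζ ^ 15 ≤ ζ := by
          calc ζ ^ 15 = ζ ^ 14 * ζ := by ring
            _ ≤ 1 * ζ := by gcongr; exact pow_le_one₀ hζ0.le hζ1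
            _ = ζ := one_mul _
        norm_num
        linarith
      calc (1 / (ζ / 20000)) ^ d ≤ ((2 / ζ) ^ 15) ^ d := by gcongr
        _ = (Real.exp (Real.log (2 / ζ)) ^ 15) ^ d := by rw [Real.exp_log (by positivity)]
        _ = Real.exp (15 * (d * Real.log (2 / ζ))) := by
          rw [← Real.exp_nat_mul, ← Real.exp_nat_mul]
          congr 1
          push_cast
          ring
    have hden : Real.exp (0.00495 * ζ) ^ m ≤ (1 + 0.1 * ζ * (Real.exp 0.05 - 1)) ^ m := by
      gcongr
      have h1 := exp_le_one_add_add_sq (a := 0.00495 * ζ) (by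
        rw [abs_of_pos (by positivity)]; linarith)
      have h2 := Real.add_one_le_exp (0.05 : ℝ)
      nlinarith
    rw [← Real.exp_nat_mul] at hden
    calc _ ≤ Real.exp (15 * (d * Real.log (2 / ζ))) * Real.exp (ζ / 20000 * (2 * m : ℕ)) *
          Real.exp (0.055 * (0.085 * ζ * m)) / Real.exp (m * (0.00495 * ζ)) := by
          gcongr
          exact hN.trans (by gcongr)
      _ = Real.exp (15 * (d * Real.log (2 / ζ)) + ζ / 20000 * (2 * m : ℕ) +
          0.055 * (0.085 * ζ * m) - m * (0.00495 * ζ)) := by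
          rw [Real.exp_sub, Real.exp_add, Real.exp_add]
      _ ≤ _ := by
          refine Real.exp_le_exp.2 (le_of_eq ?_)
          push_cast
          ring

end Bounds

end Run

/-! ### The majority vote and the weights -/

section Majority

variable {X : Type*}

/-- If most classifiers of a vote have a small error, the vote has a small error. -/
lemma imputedErr_majority_le [MeasurableSpace X] (D : Measure (LExample X)) [IsProbabilityMeasure D]
    (V : Set (Classifier X)) (f : ℕ → Classifier X) {t : ℕ} (ht : 0 < t) {A : Finset ℕ}
    (hA : A ⊆ Finset.range t) (hcard : 3 * t ≤ 4 * A.card) {e : ℝ}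
    (hm : ∀ r ∈ A, MeasurableSet {z : LExample X | f r z.1 ≠ (impute V z).2})
    (he : ∀ r ∈ A, imputedErr D V (f r) ≤ e) :
    imputedErr D V
      (fun x => decide (t < 2 * ((Finset.range t).filter fun r => f r x = true).card)) ≤ 3 * e := by
  set maj : Classifier X :=
    fun x => decide (t < 2 * ((Finset.range t).filter fun r => f r x = true).card) with hmaj
  have hA0 : 0 < A.card := by omega
  have he0 : 0 ≤ e := by
    obtain ⟨r, hr⟩ := Finset.card_pos.1 hA0
    exact measureReal_nonneg.trans (he r hr)
  let g : LExample X → ℝ := fun z =>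
    ∑ r ∈ A, {z : LExample X | f r z.1 ≠ (impute V z).2}.indicator (fun _ => (1 : ℝ)) z
  have hind : ∀ r ∈ A, Integrable
      ({z : LExample X | f r z.1 ≠ (impute V z).2}.indicator fun _ => (1 : ℝ)) D :=
    fun r hr => (integrable_const _).indicator (hm r hr)
  have hint : ∫ z, g z ∂D ≤ A.card * e := by
    rw [integral_finsetSum _ hind]
    calc _ ≤ ∑ _r ∈ A, e := Finset.sum_le_sum fun r hr => by
          rw [integral_indicator_const _ (hm r hr)]
          simpa [imputedErr] using he r hr
      _ = A.card * e := by simp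
  have hg0 : ∀ z, 0 ≤ g z := fun z => Finset.sum_nonneg fun r _ =>
    Set.indicator_nonneg (fun _ _ => zero_le_one) _
  have hgi : Integrable g D := integrable_finsetSum _ hind
  have hmark := mul_meas_ge_le_integral_of_nonneg (μ := D) (Filter.Eventually.of_forall hg0) hgi
    ((A.card : ℝ) - t / 2)
  -- Where the vote is wrong, at least half of all classifiers are wrong.
  have hsub : {z : LExample X | maj z.1 ≠ (impute V z).2} ⊆ {z | (A.card : ℝ) - t / 2 ≤ g z} := by
    intro z hz
    have hgz : g z = (A.filter fun r => f r z.1 ≠ (impute V z).2).card := by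
      simp only [g, Set.indicator_apply, mem_ofPred_eq]
      rw [Finset.sum_boole]
    have hhalf : t ≤ 2 * ((Finset.range t).filter fun r => f r z.1 ≠ (impute V z).2).card := by
      have hz' : maj z.1 ≠ (impute V z).2 := hz
      cases hy : (impute V z).2 with
      | false =>
        simp only [hmaj, hy, ne_eq, decide_eq_false_iff_not, not_not] at hz'
        simp only [ne_eq, Bool.not_eq_false]
        exact hz'.le
      | true =>
        simp only [hmaj, hy, ne_eq, decide_eq_true_eq, not_lt] at hz'
        have := Finset.card_filter_add_card_filter_not (s := Finset.range t)
          (fun r => f r z.1 = true)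
        simp only [Finset.card_range] at this
        simp only [ne_eq]
        omega
    have hsplit : ((Finset.range t).filter fun r => f r z.1 ≠ (impute V z).2).card ≤
        (A.filter fun r => f r z.1 ≠ (impute V z).2).card + (Finset.range t \ A).card := by
      refine (Finset.card_le_card fun r hr => ?_).trans (Finset.card_union_le _ _)
      simp only [Finset.mem_filter, Finset.mem_union, Finset.mem_sdiff] at hr ⊢
      tauto
    rw [Finset.card_sdiff_of_subset hA, Finset.card_range] at hsplit
    have hAt : A.card ≤ t := by simpa using Finset.card_le_card hA
    have hfin : 2 * A.card ≤ 2 * (A.filter fun r => f r z.1 ≠ (impute V z).2).card + t := by omega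
    have hfin' : 2 * (A.card : ℝ) ≤ 2 * (A.filter fun r => f r z.1 ≠ (impute V z).2).card + t := by
      exact_mod_cast hfin
    rw [mem_ofPred_eq, hgz]
    linarith
  have hle : imputedErr D V maj ≤ D.real {z | (A.card : ℝ) - t / 2 ≤ g z} := measureReal_mono hsub
  have hc : 3 * (t : ℝ) ≤ 4 * A.card := by exact_mod_cast hcard
  have htpos : (0 : ℝ) < t := by exact_mod_cast ht
  have hd : 0 < (A.card : ℝ) - t / 2 := by linarith
  have h1 : ((A.card : ℝ) - t / 2) * imputedErr D V maj ≤ ((A.card : ℝ) - t / 2) * (3 * e) := by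
    calc _ ≤ ((A.card : ℝ) - t / 2) * D.real {z | (A.card : ℝ) - t / 2 ≤ g z} := by gcongr
      _ ≤ A.card * e := hmark.trans hint
      _ ≤ ((A.card : ℝ) - t / 2) * (3 * e) := by nlinarith
  exact le_of_mul_le_mul_left h1 hd

/-- The weights record the failures: if in every round the weighted average error is small, then
the total weight grows slowly, and so no distribution can fail in many rounds. -/
lemma card_failures_le {k t : ℕ} (hkt : (k : ℝ) ^ 100 ≤ 2 ^ t) {α e : ℕ → Fin k → ℝ}
    {acc : ℕ → Fin k → Prop} (h0 : ∀ i, α 0 i = 1)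
    (hα : ∀ r i, α (r + 1) i = if acc r i then α r i else 2 * α r i) {ζ : ℝ} (hζ : 0 < ζ)
    (he : ∀ r i, 0 ≤ e r i) (hrej : ∀ r < t, ∀ i, ¬ acc r i → 0.6 * ζ < e r i)
    (havg : ∀ r < t, ∑ i, α r i * e r i ≤ 0.1 * ζ * ∑ i, α r i) (i : Fin k) :
    4 * ((Finset.range t).filter fun r => ¬ acc r i).card ≤ t := by
  have hpow : ∀ r, α r i = 2 ^ ((Finset.range r).filter fun r => ¬ acc r i).card := by
    intro r
    induction r with
    | zero => simp [h0]
    | succ r ih =>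
      rw [hα, Finset.range_add_one, Finset.filter_insert]
      by_cases h : acc r i
      · simp [h, ih]
      · rw [if_neg h, if_pos h, Finset.card_insert_of_notMem (by simp), pow_succ, ih, mul_comm]
  have hpos : ∀ r i, 0 < α r i := by
    intro r i
    induction r with
    | zero => simp [h0]
    | succ r ih => rw [hα]; split_ifs <;> positivity
  -- By the bound for the average error, at most one sixth of the total weight is doubled.
  have htot : ∀ r ≤ t, ∑ i, α r i ≤ k * (7 / 6) ^ r := by
    intro r hr
    induction r with
    | zero => simp [h0]
    | succ r ih =>
      have hr' : r < t := hr
      have h1 : ∑ i, α (r + 1) i ≤ ∑ i, (α r i + α r i * e r i / (0.6 * ζ)) := by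
        refine Finset.sum_le_sum fun i _ => ?_
        have hp := hpos r i
        rw [hα]
        split_ifs with h
        · have := he r i
          have : 0 ≤ α r i * e r i / (0.6 * ζ) := by positivity
          linarith
        · have := hrej r hr' i h
          have : α r i ≤ α r i * e r i / (0.6 * ζ) := by
            rw [le_div_iff₀ (by positivity)]
            exact mul_le_mul_of_nonneg_left this.le hp.le
          linarith
      have h2 : ∑ i, (α r i + α r i * e r i / (0.6 * ζ)) ≤ 7 / 6 * ∑ i, α r i := by
        rw [Finset.sum_add_distrib, ← Finset.sum_div]
        have : (∑ i, α r i * e r i) / (0.6 * ζ) ≤ 1 / 6 * ∑ i, α r i := by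
          rw [div_le_iff₀ (by positivity)]
          refine (havg r hr').trans (le_of_eq ?_)
          ring
        linarith
      calc _ ≤ 7 / 6 * ∑ i, α r i := h1.trans h2
        _ ≤ 7 / 6 * (k * (7 / 6) ^ r) := by gcongr; exact ih hr'.le
        _ = _ := by rw [pow_succ]; ring
  set c := ((Finset.range t).filter fun r => ¬ acc r i).card
  have h1 : (2 : ℝ) ^ c ≤ k * (7 / 6) ^ t := by
    rw [← hpow t]
    exact (Finset.single_le_sum (fun i _ => (hpos t i).le) (Finset.mem_univ i)).trans
      (htot t le_rfl)
  -- From `2 ^ c ≤ k (7 / 6) ^ t`, where `7 / 6 ≤ 2 ^ (6 / 25)`, and `k ≤ 2 ^ (t / 100)`.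
  have h2 : (2 : ℝ) ^ (100 * c) ≤ 2 ^ (25 * t) := by
    calc (2 : ℝ) ^ (100 * c) = (2 ^ c) ^ 100 := by rw [← pow_mul, mul_comm]
      _ ≤ (k * (7 / 6) ^ t) ^ 100 := by gcongr
      _ = k ^ 100 * ((7 / 6) ^ 25) ^ (4 * t) := by
        rw [mul_pow, ← pow_mul, ← pow_mul]; congr 2; ring
      _ ≤ 2 ^ t * (2 ^ 6) ^ (4 * t) := by gcongr; norm_num
      _ = 2 ^ (25 * t) := by rw [← pow_mul, ← pow_add]; congr 1; ring
  have h3 : 100 * c ≤ 25 * t := (pow_le_pow_iff_right₀ (by norm_num : (1 : ℝ) < 2)).1 h2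
  omega

end Majority

/-! ### A run without bad events -/

/-- The constants of the passive learner for which the guarantee is proved. The thresholds for the
errors of a round are `0.08 < 0.085 < 0.1` for the optimum and the minimizer and
`0.6 < 0.62 < 0.64` for the tests; the gaps are paid for by the large sample size. -/
noncomputable def passiveConstants : PassiveConstants where
  rounds := 100
  boost := 2
  tol := 0.62
  size := 100000
  rounds_pos := by norm_num
  one_lt_boost := by norm_num
  tol_pos := by norm_num
  tol_lt_one := by norm_num
  size_pos := by norm_num

lemma numRounds_pos (k : ℕ) (hk : 0 < k) : 0 < numRounds passiveConstants k := by
  refine Nat.ceil_pos.2 (mul_pos passiveConstants.rounds_pos (Real.logb_pos (by norm_num) ?_))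
  have : (1 : ℝ) ≤ k := by exact_mod_cast hk
  linarith

lemma pow_le_two_pow_numRounds (k : ℕ) (hk : 0 < k) :
    (k : ℝ) ^ 100 ≤ 2 ^ numRounds passiveConstants k := by
  have hk' : (0 : ℝ) < k := by exact_mod_cast hk
  calc (k : ℝ) ^ 100 ≤ (2 * k) ^ 100 := by gcongr; linarith
    _ = (2 : ℝ) ^ (100 * Real.logb 2 (2 * k)) := by
      rw [mul_comm (100 : ℝ), Real.rpow_mul (by norm_num), Real.rpow_logb (by norm_num)
        (by norm_num) (by positivity)]
      norm_cast
    _ ≤ (2 : ℝ) ^ (numRounds passiveConstants k : ℝ) :=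
      Real.rpow_le_rpow_of_exponent_le (by norm_num) (Nat.le_ceil _)
    _ = _ := Real.rpow_natCast _ _

section Rho

variable {X : Type*} [MeasurableSpace X] {k : ℕ}

lemma err_le_mdErr (D : Fin k → Measure (LExample X)) (h : Classifier X) (i : Fin k) :
    err (D i) h ≤ mdErr D h :=
  le_ciSup (f := fun i => err (D i) h) (Set.finite_range _).bddAbove i

lemma rho_le_mdRho (D : Fin k → Measure (LExample X)) (h h' : Classifier X) (i : Fin k) :
    rho (D i) h h' ≤ mdRho D h h' :=
  le_ciSup (f := fun i => rho (D i) h h') (Set.finite_range _).bddAbove i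

lemma rho_comm (D : Measure (LExample X)) (h h' : Classifier X) : rho D h h' = rho D h' h := by
  simp only [rho, ne_comm]

lemma rho_triangle (D : Measure (LExample X)) [IsProbabilityMeasure D] (h₁ h₂ h₃ : Classifier X) :
    rho D h₁ h₃ ≤ rho D h₁ h₂ + rho D h₂ h₃ := by
  refine (measureReal_mono fun z hz => ?_).trans (measureReal_union_le _ _)
  by_contra hne
  simp only [mem_union, mem_ofPred_eq, not_or, not_not] at hne hz
  exact hz (hne.1.trans hne.2)

lemma rho_le_imputedErr_add (D : Measure (LExample X)) [IsProbabilityMeasure D]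
    (V : Set (Classifier X)) (h h' : Classifier X) :
    rho D h h' ≤ imputedErr D V h + imputedErr D V h' := by
  refine (measureReal_mono fun z hz => ?_).trans (measureReal_union_le _ _)
  by_contra hne
  simp only [mem_union, mem_ofPred_eq, not_or, not_not] at hne hz
  exact hz (hne.1.trans hne.2.symm)

lemma err_le_err_add_rho (D : Measure (LExample X)) [IsProbabilityMeasure D] (h h' : Classifier X) :
    err D h ≤ err D h' + rho D h h' := by
  refine (measureReal_mono fun z hz => ?_).trans (measureReal_union_le _ _)
  by_contra hne
  simp only [mem_union, mem_ofPred_eq, not_or, not_not] at hne hz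
  exact hz (hne.2.trans hne.1)

lemma disCoeff_bddAbove (D : Measure (LExample X)) [IsProbabilityMeasure D]
    (H : Set (Classifier X)) (h : Classifier X) {r₀ : ℝ} (hr₀ : 0 < r₀) :
    BddAbove (Set.range fun r : Ici r₀ =>
      D.real {z : LExample X | z.1 ∈ DIS (disBall D H h r)} / (r : ℝ)) := by
  refine ⟨1 / r₀, ?_⟩
  rintro _ ⟨r, rfl⟩
  exact div_le_div₀ zero_le_one measureReal_le_one hr₀ r.2

/-- The defining inequality of the disagreement coefficient. -/
lemma measureReal_DIS_le (D : Fin k → Measure (LExample X)) [∀ i, IsProbabilityMeasure (D i)]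
    (H : Set (Classifier X)) (h : Classifier X) {r₀ r : ℝ} (hr₀ : 0 < r₀) (hr : r₀ ≤ r) (i : Fin k)
    {V : Set (Classifier X)} (hV : V ⊆ disBall (D i) H h r) :
    (D i).real {z | z.1 ∈ DIS V} ≤ disCoeffMax D H h r₀ * r := by
  have hr' : 0 < r := hr₀.trans_le hr
  rw [← div_le_iff₀ hr']
  have h1 : (D i).real {z | z.1 ∈ DIS V} ≤ (D i).real {z | z.1 ∈ DIS (disBall (D i) H h r)} := by
    refine measureReal_mono fun z hz => ?_
    obtain ⟨h₁, m₁, h₂, m₂, hne⟩ := hz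
    exact ⟨h₁, hV m₁, h₂, hV m₂, hne⟩
  calc _ ≤ (D i).real {z | z.1 ∈ DIS (disBall (D i) H h r)} / r := by gcongr
    _ ≤ disCoeff (D i) H h r₀ :=
      le_ciSup (disCoeff_bddAbove (D i) H h hr₀) (⟨r, hr⟩ : Ici r₀)
    _ ≤ _ := le_ciSup (f := fun i => disCoeff (D i) H h r₀) (Set.finite_range _).bddAbove i

lemma disCoeffMax_nonneg (D : Fin k → Measure (LExample X)) (H : Set (Classifier X))
    (h : Classifier X) {r₀ : ℝ} (hr₀ : 0 < r₀) : 0 ≤ disCoeffMax D H h r₀ :=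
  Real.iSup_nonneg fun _ => Real.iSup_nonneg fun r =>
    div_nonneg measureReal_nonneg (hr₀.le.trans r.2)

end Rho

section GoodRun

variable {X : Type*} [MeasurableSpace X] {k : ℕ} [NeZero k]
variable {erm : Rule X} {D : Fin k → Measure (LExample X)} [∀ i, IsProbabilityMeasure (D i)]
  {H : Set (Classifier X)} {d : ℕ} {δ ε : ℝ}

/-- In a phase without bad events the optimum survives: its distance to the output of the passive
learner is at most twice the target error. -/
lemma rho_passiveMDL_le (hrun : MeasurableRun passiveConstants erm D H d ε δ) (herm : IsERM erm)
    {hstar : Classifier X} {n : ℕ} (hn : n < numPhases ε) {ω : Draws X k}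
    (hmem : hstar ∈ versionSpace passiveConstants erm D H d δ ω n)
    (hopt : ∀ i, err (D i) hstar ≤ 0.08 * phaseErr (n + 1))
    (h1 : ∀ r < numRounds passiveConstants k,
      ω ∉ BadOptimum passiveConstants erm D H d δ hstar n r)
    (h2 : ∀ r < numRounds passiveConstants k, ω ∉ BadMinimizer passiveConstants erm D H d δ n r)
    (h3 : ∀ r < numRounds passiveConstants k, ∀ i, ω ∉ BadTest passiveConstants erm D H d δ n r i)
    (i : Fin k) :
    rho (D i) hstar (passiveMDL passiveConstants erm d
      (versionSpace passiveConstants erm D H d δ ω n) (phaseErr (n + 1)) (phaseConf δ (n + 1))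
      (phaseDraws ω (n + 1))) ≤ 2 * phaseErr (n + 1) := by
  set V := versionSpace passiveConstants erm D H d δ ω n with hV
  set ζ := phaseErr (n + 1) with hζ
  set t := numRounds passiveConstants k with ht
  have hk : 0 < k := Nat.pos_of_ne_zero (NeZero.ne k)
  have ht0 : 0 < t := numRounds_pos k hk
  set f : ℕ → Classifier X := fun r => phaseClassifier passiveConstants erm D H d δ n r ω with hf
  set acc : ℕ → Fin k → Prop := fun r i => PhaseAccepts passiveConstants erm D H d δ n r i ω
  have havg : ∀ r < t, ∑ i, phaseWeights passiveConstants erm D H d δ n r ω i *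
      imputedErr (D i) V (f r) ≤
        0.1 * ζ * ∑ i, phaseWeights passiveConstants erm D H d δ n r ω i := by
    intro r hr
    by_contra hlt
    refine h2 r hr ⟨⟨hstar, hmem⟩, ?_, not_le.1 hlt⟩
    exact ((herm V ⟨hstar, hmem⟩ _ _).2 hstar hmem).trans ((empErr_impute_le hmem _).trans
      (not_lt.1 (h1 r hr)))
  have hrej : ∀ r < t, ∀ i, ¬ acc r i → 0.6 * ζ < imputedErr (D i) V (f r) := by
    intro r hr i hacc
    by_contra hlt
    exact h3 r hr i (Or.inr ⟨hacc, not_lt.1 hlt⟩)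
  have hfail := card_failures_le (pow_le_two_pow_numRounds k hk)
    (α := fun r => phaseWeights passiveConstants erm D H d δ n r ω) (acc := acc)
    (fun _ => rfl) (fun r i => phaseWeights_succ passiveConstants erm D H d δ n r ω i)
    (phaseErr_pos (n + 1)) (fun _ _ => measureReal_nonneg) hrej havg i
  have hmaj := imputedErr_majority_le (D i) V f ht0 (A := (Finset.range t).filter fun r => acc r i)
    (Finset.filter_subset _ _) (by
      have := Finset.card_filter_add_card_filter_not (s := Finset.range t) (fun r => acc r i)
      rw [Finset.card_range] at this
      change 4 * ((Finset.range t).filter fun r => ¬ acc r i).card ≤ t at hfail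
      omega) (e := 0.64 * ζ)
    (fun r hr => (measurableSet_loss hrun hn
      (Finset.mem_range.1 (Finset.mem_filter.1 hr).1)).preimage
      (f := fun z => (ω, z)) (by fun_prop))
    (fun r hr => by
      obtain ⟨hr, hacc⟩ := Finset.mem_filter.1 hr
      by_contra hlt
      exact h3 r (Finset.mem_range.1 hr) i (Or.inl ⟨hacc, (not_le.1 hlt).le⟩))
  refine (rho_le_imputedErr_add (D i) V _ _).trans ?_
  have hs := (imputedErr_le_err (D i) hmem).trans (hopt i)
  have hmaj' : imputedErr (D i) V (passiveMDL passiveConstants erm d V ζ (phaseConf δ (n + 1))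
      (phaseDraws ω (n + 1))) ≤ 3 * (0.64 * ζ) := hmaj
  linarith

/-- Without bad events the optimum belongs to all version spaces. -/
lemma mem_versionSpace (hrun : MeasurableRun passiveConstants erm D H d ε δ) (herm : IsERM erm)
    {hstar : Classifier X} (hH : hstar ∈ H) {ω : Draws X k}
    (hopt : ∀ n < numPhases ε, ∀ i, err (D i) hstar ≤ 0.08 * phaseErr (n + 1))
    (h1 : ∀ n < numPhases ε, ∀ r < numRounds passiveConstants k,
      ω ∉ BadOptimum passiveConstants erm D H d δ hstar n r)
    (h2 : ∀ n < numPhases ε, ∀ r < numRounds passiveConstants k,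
      ω ∉ BadMinimizer passiveConstants erm D H d δ n r)
    (h3 : ∀ n < numPhases ε, ∀ r < numRounds passiveConstants k, ∀ i,
      ω ∉ BadTest passiveConstants erm D H d δ n r i) {n : ℕ} (hn : n ≤ numPhases ε) :
    hstar ∈ versionSpace passiveConstants erm D H d δ ω n := by
  induction n with
  | zero => exact hH
  | succ n ih =>
    have hn' : n < numPhases ε := hn
    have hmem := ih hn'.le
    refine ⟨hmem, ciSup_le fun i => ?_⟩
    exact rho_passiveMDL_le hrun herm hn' hmem (hopt n hn') (h1 n hn') (h2 n hn') (h3 n hn') i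

/-- A version space that contains the optimum lies in a small ball around it. -/
lemma versionSpace_subset_disBall (κ : PassiveConstants) {hstar : Classifier X} {ω : Draws X k}
    {n : ℕ} (hmem : hstar ∈ versionSpace κ erm D H d δ ω n) (i : Fin k) :
    versionSpace κ erm D H d δ ω n ⊆ disBall (D i) H hstar (4 * phaseErr n) := by
  intro h hh
  refine ⟨versionSpace_subset κ erm D H d δ ω n hh, ?_⟩
  cases n with
  | zero =>
    refine (measureReal_le_one : rho (D i) hstar h ≤ 1).trans ?_
    norm_num [phaseErr]
  | succ n =>
    have h1 := (rho_le_mdRho D _ _ i).trans hmem.2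
    have h2 := (rho_le_mdRho D _ _ i).trans hh.2
    rw [rho_comm] at h2
    have h3 := (rho_triangle (D i) _ _ _).trans (add_le_add h1 h2)
    linarith

end GoodRun

/-! ### Estimates of the parameters -/

section Parameters

lemma logb_two_le {x : ℝ} (hx : 0 < x) : Real.logb 2 x ≤ x := by
  have h2 := Real.log_two_gt_d9
  have h2' := Real.log_two_lt_d9
  have h : Real.log x ≤ x / 2 := by
    have h1 := Real.log_le_sub_one_of_pos (half_pos hx)
    rw [Real.log_div hx.ne' (by norm_num)] at h1
    linarith
  rw [Real.logb, div_le_iff₀ (by linarith)]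
  nlinarith

lemma two_pow_lt_of_lt_numPhases {ε : ℝ} (hε : 0 < ε) {n : ℕ} (hn : n < numPhases ε) :
    (2 : ℝ) ^ n < 4 / ε := by
  have h1 : (n : ℝ) < Real.logb 2 (4 / ε) := Nat.lt_ceil.1 hn
  rwa [Real.lt_logb_iff_rpow_lt (by norm_num) (by positivity), Real.rpow_natCast] at h1

lemma four_mul_phaseErr_numPhases_le {ε : ℝ} (hε : 0 < ε) :
    4 * phaseErr (numPhases ε) ≤ ε := by
  have h1 : Real.logb 2 (4 / ε) ≤ numPhases ε := Nat.le_ceil _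
  rw [Real.logb_le_iff_le_rpow (by norm_num) (by positivity), Real.rpow_natCast,
    div_le_iff₀ hε] at h1
  rw [phaseErr, inv_pow, ← div_eq_mul_inv, div_le_iff₀ (by positivity)]
  linarith

lemma le_four_mul_phaseErr {ε : ℝ} (hε : 0 < ε) {n : ℕ} (hn : n < numPhases ε) :
    ε ≤ 4 * phaseErr n := by
  have h1 := two_pow_lt_of_lt_numPhases hε hn
  rw [lt_div_iff₀ hε] at h1
  rw [phaseErr, inv_pow, ← div_eq_mul_inv, le_div_iff₀ (by positivity)]
  linarith

lemma phaseErr_succ (n : ℕ) : phaseErr n = 2 * phaseErr (n + 1) := by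
  rw [phaseErr, phaseErr, pow_succ]; ring

lemma numPhases_le {ε : ℝ} (hε : 0 < ε) (hε1 : ε < 1) :
    (numPhases ε : ℝ) ≤ 5 * Real.log (2 / ε) := by
  have h2 := Real.log_two_gt_d9
  have h0 : 0 ≤ Real.logb 2 (4 / ε) :=
    Real.logb_nonneg (by norm_num) (by rw [le_div_iff₀ hε]; linarith)
  have h1 := (Nat.ceil_lt_add_one h0).le
  have h3 : Real.log 2 ≤ Real.log (2 / ε) :=
    Real.log_le_log (by norm_num) (by rw [le_div_iff₀ hε]; linarith)
  have h4 : Real.log (4 / ε) = Real.log 2 + Real.log (2 / ε) := by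
    rw [← Real.log_mul (by norm_num) (by positivity)]
    congr 1
    ring
  refine h1.trans ?_
  rw [Real.logb, h4, ← le_sub_iff_add_le, div_le_iff₀ (by linarith)]
  nlinarith

lemma numRounds_le (k : ℕ) (hk : 0 < k) : (numRounds passiveConstants k : ℝ) ≤ 201 * k := by
  have hk1 : (1 : ℝ) ≤ k := by exact_mod_cast hk
  have h1 := logb_two_le (x := 2 * k) (by linarith)
  have h0 : 0 ≤ Real.logb 2 (2 * k) := Real.logb_nonneg (by norm_num) (by linarith)
  have h2 := (Nat.ceil_lt_add_one (a := 100 * Real.logb 2 (2 * k)) (by positivity)).le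
  exact h2.trans (by linarith)

/-- The bounds for the confidence parameter of a round, for the logarithms in the sample sizes and
for the number of rounds, in terms of the logarithm in the query bound. -/
lemma parameter_bounds {k : ℕ} (hk : 0 < k) (d : ℕ) {ε δ : ℝ} (hε : 0 < ε) (hε1 : ε < 1)
    (hδ : 0 < δ) (hδ1 : δ < 1) {n : ℕ} (hn : n < numPhases ε) :
    let Λ := Real.log (4 * (d + k) / (ε * δ))
    let δ' := roundConf passiveConstants k (phaseConf δ (n + 1))
    0 < δ' ∧ δ' ≤ 1 / 4 ∧ 1 ≤ Λ ∧ Real.log (2 / phaseErr (n + 1)) ≤ 2 * Λ ∧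
      Real.log (2 * k / δ') ≤ 9 * Λ ∧ Real.log (1 / δ') ≤ 9 * Λ ∧
      (numRounds passiveConstants k : ℝ) ≤ 200 * Λ := by
  intro Λ δ'
  have hk1 : (1 : ℝ) ≤ k := by exact_mod_cast hk
  have hd0 : (0 : ℝ) ≤ d := Nat.cast_nonneg d
  have ht0 : (0 : ℝ) < numRounds passiveConstants k := by exact_mod_cast numRounds_pos k hk
  have ht1 : (1 : ℝ) ≤ numRounds passiveConstants k := by exact_mod_cast numRounds_pos k hk
  have htk := numRounds_le k hk
  set t : ℝ := (numRounds passiveConstants k : ℝ) with ht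
  set Y : ℝ := 4 * (d + k) / (ε * δ) with hY
  have hεδ : 0 < ε * δ := mul_pos hε hδ
  have hεδ1 : ε * δ ≤ ε := by nlinarith
  have hεδ2 : ε * δ ≤ δ := by nlinarith
  have hY4ε : 4 / ε ≤ Y := by
    rw [hY]
    exact div_le_div₀ (by positivity) (by linarith) hεδ hεδ1
  have hY4 : 4 ≤ Y := le_trans (by rw [le_div_iff₀ hε]; linarith) hY4ε
  have hYk : 4 * k / (ε * δ) ≤ Y := by rw [hY]; gcongr; linarith
  have hn1 : (0 : ℝ) < ((n + 1 : ℕ) : ℝ) := by positivity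
  have hn1' : (1 : ℝ) ≤ ((n + 1 : ℕ) : ℝ) := by push_cast; linarith [Nat.cast_nonneg (α := ℝ) n]
  have hδ' : δ' = δ / (2 * ((n + 1 : ℕ) : ℝ) ^ 2 * (4 * t)) := by
    simp only [δ', roundConf, phaseConf, div_div, ht]
  have hδ'0 : 0 < δ' := by rw [hδ']; positivity
  have hδ'1 : δ' ≤ 1 / 4 := by
    rw [hδ']
    refine div_le_div₀ zero_le_one hδ1.le (by norm_num) ?_
    nlinarith [one_le_pow₀ hn1' (n := 2)]
  have hΛ : 1 ≤ Λ := by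
    rw [Real.le_log_iff_exp_le (by linarith)]
    linarith [Real.exp_one_lt_d9]
  have hL : Real.log (2 / phaseErr (n + 1)) ≤ 2 * Λ := by
    have h1 := two_pow_lt_of_lt_numPhases hε hn
    have h2 : 2 / phaseErr (n + 1) ≤ Y ^ 2 := by
      rw [phaseErr, inv_pow, div_inv_eq_mul, pow_succ]
      nlinarith
    calc _ ≤ Real.log (Y ^ 2) := Real.log_le_log (div_pos two_pos (phaseErr_pos _)) h2
      _ = 2 * Λ := by rw [Real.log_pow]; push_cast; rfl
  have hn5 : ((n + 1 : ℕ) : ℝ) ≤ 5 / ε := by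
    have h1 : (n : ℝ) < Real.logb 2 (4 / ε) := Nat.lt_ceil.1 hn
    have h2 := logb_two_le (x := 4 / ε) (by positivity)
    have h3 : 1 ≤ 1 / ε := by rw [le_div_iff₀ hε]; linarith
    have h4 : 5 / ε = 4 / ε + 1 / ε := by ring
    push_cast
    linarith
  have hconf : 2 * k / δ' ≤ Y ^ 9 := by
    have h1 : 2 * k / δ' = 16 * k * t * ((n + 1 : ℕ) : ℝ) ^ 2 / δ := by
      rw [hδ']; field_simp; ring
    calc 2 * k / δ' = 16 * k * t * ((n + 1 : ℕ) : ℝ) ^ 2 / δ := h1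
      _ ≤ 16 * k * (201 * k) * (5 / ε) ^ 2 / δ := by gcongr
      _ = 5025 * (4 * k / (ε * δ)) ^ 2 * δ := by field_simp; norm_num
      _ ≤ 5025 * (4 * k / (ε * δ)) ^ 2 * 1 := by gcongr
      _ ≤ Y ^ 7 * Y ^ 2 * 1 := by
        gcongr
        calc (5025 : ℝ) ≤ 4 ^ 7 := by norm_num
          _ ≤ Y ^ 7 := by gcongr
      _ = Y ^ 9 := by ring
  have hlog : Real.log (2 * k / δ') ≤ 9 * Λ := by
    calc _ ≤ Real.log (Y ^ 9) := Real.log_le_log (by positivity) hconf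
      _ = 9 * Λ := by rw [Real.log_pow]; push_cast; rfl
  refine ⟨hδ'0, hδ'1, hΛ, hL, hlog, le_trans (Real.log_le_log (by positivity) ?_) hlog, ?_⟩
  · gcongr; linarith
  · have h0 : 0 ≤ Real.logb 2 (2 * k) := Real.logb_nonneg (by norm_num) (by linarith)
    have h2 := (Nat.ceil_lt_add_one (a := 100 * Real.logb 2 (2 * k)) (by positivity)).le
    refine h2.trans ?_
    have h3 : Real.log (2 * k) ≤ Λ := by
      refine Real.log_le_log (by positivity) (le_trans ?_ hYk)
      rw [le_div_iff₀ hεδ]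
      nlinarith
    have h4 := Real.log_two_gt_d9
    have h5 : Real.logb 2 (2 * k) ≤ 1.9 * Λ := by
      rw [Real.logb, div_le_iff₀ (by linarith)]
      nlinarith
    linarith

lemma mul_ceil_div_le {ζ a : ℝ} (hζ0 : 0 < ζ) (hζ1 : ζ ≤ 1) (ha : 0 ≤ a) :
    ζ * (⌈a / ζ⌉₊ : ℝ) ≤ a + 1 := by
  have h := mul_le_mul_of_nonneg_left (Nat.ceil_lt_add_one (div_nonneg ha hζ0.le)).le hζ0.le
  rw [mul_add, mul_div_cancel₀ _ hζ0.ne', mul_one] at h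
  linarith

end Parameters

/-! ### The failure probability -/

section Failure

variable {X : Type*} [MeasurableSpace X] {k : ℕ} [NeZero k]
variable {erm : Rule X} {D : Fin k → Measure (LExample X)} [∀ i, IsProbabilityMeasure (D i)]
  {H : Set (Classifier X)} {d : ℕ} {δ ε : ℝ}

/-- All bad events of round `r` of phase `n + 1`. -/
def BadRound (erm : Rule X) (D : Fin k → Measure (LExample X)) (H : Set (Classifier X)) (d : ℕ)
    (δ : ℝ) (hstar : Classifier X) (q y : ℝ) (n r : ℕ) : Set (Draws X k) :=
  BadOptimum passiveConstants erm D H d δ hstar n r ∪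
    (BadMinimizer passiveConstants erm D H d δ n r ∪
      ((⋃ i, BadTest passiveConstants erm D H d δ n r i) ∪
        (BadMixQueries passiveConstants erm D H d δ q y n r ∪
          BadTestQueries passiveConstants erm D H d δ q y n r)))

/-- Each of the five events has probability at most `δ' ^ 2`, where `δ'` is the confidence parameter
of the round, and `5 δ' ^ 2 ≤ 4 δ'`. -/
lemma drawLaw_badRound_le (hrun : MeasurableRun passiveConstants erm D H d ε δ) (herm : IsERM erm)
    (hd : vcDim H = d) (x : X) (hε : 0 < ε) (hε1 : ε < 1) (hδ : 0 < δ) (hδ1 : δ < 1)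
    {hstar : Classifier X} (hh : Measurable hstar) {q : ℝ} (hq : 0 ≤ q) {n r : ℕ}
    (hn : n < numPhases ε) (hr : r < numRounds passiveConstants k)
    (hopt : ∀ i, err (D i) hstar ≤ 0.08 * phaseErr (n + 1)) :
    drawLaw D (BadRound erm D H d δ hstar q
      (2 * Real.log (1 / roundConf passiveConstants k (phaseConf δ (n + 1)))) n r) ≤
      ENNReal.ofReal (4 * roundConf passiveConstants k (phaseConf δ (n + 1))) := by
  have hk : 0 < k := Nat.pos_of_ne_zero (NeZero.ne k)
  have hk1 : (1 : ℝ) ≤ k := by exact_mod_cast hk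
  obtain ⟨hδ'0, hδ'1, -⟩ := parameter_bounds hk d hε hε1 hδ hδ1 hn
  have hζ0 := phaseErr_pos (n + 1)
  have hζ1 := phaseErr_le_one (n + 1)
  have hm : 100000 * (d * Real.log (2 / phaseErr (n + 1)) +
      Real.log (1 / roundConf passiveConstants k (phaseConf δ (n + 1)))) ≤
      phaseErr (n + 1) * mixSize passiveConstants k d (phaseErr (n + 1)) (phaseConf δ (n + 1)) := by
    rw [mul_comm (phaseErr (n + 1)), ← div_le_iff₀ hζ0]
    exact Nat.le_ceil _
  have hm' : 100000 * Real.log (2 * k / roundConf passiveConstants k (phaseConf δ (n + 1))) ≤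
      phaseErr (n + 1) * testSize passiveConstants k (phaseErr (n + 1)) (phaseConf δ (n + 1)) := by
    rw [mul_comm (phaseErr (n + 1)), ← div_le_iff₀ hζ0]
    exact Nat.le_ceil _
  set δ' := roundConf passiveConstants k (phaseConf δ (n + 1)) with hδ'
  have hL : 0 ≤ Real.log (2 / phaseErr (n + 1)) :=
    Real.log_nonneg (by rw [le_div_iff₀ hζ0]; linarith)
  have hdL : 0 ≤ d * Real.log (2 / phaseErr (n + 1)) := by positivity
  have hℓ : 0 ≤ Real.log (1 / δ') := Real.log_nonneg (by rw [le_div_iff₀ hδ'0]; linarith)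
  have hℓk : 0 ≤ Real.log (2 * k / δ') := Real.log_nonneg (by rw [le_div_iff₀ hδ'0]; linarith)
  have hexp : Real.exp (-(2 * Real.log (1 / δ'))) = δ' ^ 2 := by
    rw [one_div, Real.log_inv, mul_neg, neg_neg, mul_comm, Real.exp_mul, Real.exp_log hδ'0]
    norm_cast
  have e1 : drawLaw D (BadOptimum passiveConstants erm D H d δ hstar n r) ≤
      ENNReal.ofReal (δ' ^ 2) := by
    refine (drawLaw_badOptimum_le hrun hh hn hr hopt).trans (ENNReal.ofReal_le_ofReal ?_)
    rw [← hexp]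
    exact Real.exp_le_exp.2 (by linarith)
  have e2 : drawLaw D (BadMinimizer passiveConstants erm D H d δ n r) ≤
      ENNReal.ofReal (δ' ^ 2) := by
    refine (drawLaw_badMinimizer_le hrun herm hd x hn hr).trans (ENNReal.ofReal_le_ofReal ?_)
    rw [← hexp]
    exact Real.exp_le_exp.2 (by linarith)
  have e3 : drawLaw D (⋃ i, BadTest passiveConstants erm D H d δ n r i) ≤
      ENNReal.ofReal (δ' ^ 2) := by
    refine (measure_iUnion_fintype_le _ _).trans ?_
    have h1 : ∀ i, drawLaw D (BadTest passiveConstants erm D H d δ n r i) ≤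
        ENNReal.ofReal ((δ' / (2 * k)) ^ 2) := by
      intro i
      refine (drawLaw_badTest_le hrun rfl hn hr i).trans (ENNReal.ofReal_le_ofReal ?_)
      have : (δ' / (2 * k)) ^ 2 = Real.exp (-(2 * Real.log (2 * k / δ'))) := by
        rw [← inv_div, ← mul_neg, ← Real.log_inv, mul_comm 2 (Real.log _), Real.exp_mul,
          Real.exp_log (by positivity)]
        norm_cast
      rw [this]
      exact Real.exp_le_exp.2 (by linarith)
    refine (Finset.sum_le_sum fun i _ => h1 i).trans ?_
    rw [Finset.sum_const, Finset.card_univ, Fintype.card_fin, nsmul_eq_mul,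
      ← ENNReal.ofReal_natCast, ← ENNReal.ofReal_mul (Nat.cast_nonneg k)]
    refine ENNReal.ofReal_le_ofReal ?_
    rw [div_pow, mul_div_assoc', div_le_iff₀ (by positivity), mul_comm]
    gcongr
    nlinarith
  have e4 : drawLaw D (BadMixQueries passiveConstants erm D H d δ q (2 * Real.log (1 / δ')) n r) ≤
      ENNReal.ofReal (δ' ^ 2) := by
    rw [← hexp]
    exact drawLaw_badMixQueries_le hrun hq _ hn hr
  have e5 : drawLaw D (BadTestQueries passiveConstants erm D H d δ q (2 * Real.log (1 / δ')) n r) ≤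
      ENNReal.ofReal (δ' ^ 2) := by
    rw [← hexp]
    exact drawLaw_badTestQueries_le hrun q _ r hn
  have hsq : 0 ≤ δ' ^ 2 := sq_nonneg _
  calc _ ≤ ENNReal.ofReal (δ' ^ 2) + (ENNReal.ofReal (δ' ^ 2) + (ENNReal.ofReal (δ' ^ 2) +
        (ENNReal.ofReal (δ' ^ 2) + ENNReal.ofReal (δ' ^ 2)))) :=
        (measure_union_le _ _).trans (add_le_add e1 ((measure_union_le _ _).trans (add_le_add e2
          ((measure_union_le _ _).trans (add_le_add e3 ((measure_union_le _ _).trans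
            (add_le_add e4 e5)))))))
    _ = ENNReal.ofReal (5 * δ' ^ 2) := by
        rw [← ENNReal.ofReal_add hsq hsq, ← ENNReal.ofReal_add hsq (by positivity),
          ← ENNReal.ofReal_add hsq (by positivity), ← ENNReal.ofReal_add hsq (by positivity)]
        congr 1
        ring
    _ ≤ ENNReal.ofReal (4 * δ') := ENNReal.ofReal_le_ofReal (by nlinarith)

/-- The failure probabilities `δ / (2 n ^ 2)` add up to at most `δ`. -/
lemma sum_phaseConf_le (hδ : 0 < δ) (N : ℕ) :
    ∑ n ∈ Finset.range N, phaseConf δ (n + 1) ≤ δ := by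
  have h : ∀ N : ℕ, ∑ n ∈ Finset.range (N + 1), phaseConf δ (n + 1) ≤
      δ * (1 - 1 / (2 * (N + 1))) := by
    intro N
    induction N with
    | zero => norm_num [phaseConf]; linarith
    | succ N ih =>
      rw [Finset.sum_range_succ]
      have h1 : phaseConf δ (N + 1 + 1) ≤
          δ * (1 / (2 * ((N : ℝ) + 1)) - 1 / (2 * ((N : ℝ) + 1 + 1))) := by
        rw [phaseConf, div_eq_mul_one_div]
        push_cast
        gcongr
        rw [div_sub_div _ _ (by positivity) (by positivity), div_le_div_iff₀ (by positivity)
          (by positivity)]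
        nlinarith [Nat.cast_nonneg (α := ℝ) N]
      push_cast
      linarith
  cases N with
  | zero => simpa using hδ.le
  | succ N =>
    refine (h N).trans ?_
    have : (0 : ℝ) ≤ 1 / (2 * (N + 1)) := by positivity
    nlinarith

/-- The union bound over all rounds of all phases. -/
lemma drawLaw_iUnion_badRound_le (hrun : MeasurableRun passiveConstants erm D H d ε δ)
    (herm : IsERM erm) (hd : vcDim H = d) (x : X) (hε : 0 < ε) (hε1 : ε < 1) (hδ : 0 < δ)
    (hδ1 : δ < 1) {hstar : Classifier X} (hh : Measurable hstar) {q : ℕ → ℝ} (hq : ∀ n, 0 ≤ q n)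
    (hopt : ∀ n < numPhases ε, ∀ i, err (D i) hstar ≤ 0.08 * phaseErr (n + 1)) :
    drawLaw D (⋃ n ∈ Finset.range (numPhases ε),
      ⋃ r ∈ Finset.range (numRounds passiveConstants k), BadRound erm D H d δ hstar (q n)
        (2 * Real.log (1 / roundConf passiveConstants k (phaseConf δ (n + 1)))) n r) ≤
      ENNReal.ofReal δ := by
  have ht : (numRounds passiveConstants k : ℝ) ≠ 0 := by
    exact_mod_cast (numRounds_pos k (Nat.pos_of_ne_zero (NeZero.ne k))).ne'
  have hconf : ∀ n, 0 ≤ phaseConf δ (n + 1) := fun n => by unfold phaseConf; positivity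
  refine (measure_biUnion_finset_le _ _).trans ?_
  calc _ ≤ ∑ n ∈ Finset.range (numPhases ε), ENNReal.ofReal (phaseConf δ (n + 1)) := by
        refine Finset.sum_le_sum fun n hn => (measure_biUnion_finset_le _ _).trans ?_
        have hn' := Finset.mem_range.1 hn
        refine (Finset.sum_le_sum fun r hr => drawLaw_badRound_le hrun herm hd x hε hε1 hδ hδ1 hh
          (hq n) hn' (Finset.mem_range.1 hr) (hopt n hn')).trans (le_of_eq ?_)
        rw [Finset.sum_const, Finset.card_range, nsmul_eq_mul, ← ENNReal.ofReal_natCast,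
          ← ENNReal.ofReal_mul (Nat.cast_nonneg _), roundConf]
        congr 1
        field_simp
    _ = ENNReal.ofReal (∑ n ∈ Finset.range (numPhases ε), phaseConf δ (n + 1)) :=
        (ENNReal.ofReal_sum_of_nonneg fun n _ => hconf n).symm
    _ ≤ ENNReal.ofReal δ := ENNReal.ofReal_le_ofReal (sum_phaseConf_le hδ _)

end Failure

/-! ### The number of label queries -/

section Queries

variable {X : Type*} [MeasurableSpace X] {k : ℕ} [NeZero k]
variable {erm : Rule X} {D : Fin k → Measure (LExample X)}
  {H : Set (Classifier X)} {d : ℕ} {δ ε : ℝ}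

lemma card_filter_range_eq (m : ℕ) (P : ℕ → Prop) :
    ((Finset.range m).filter P).card = (Finset.univ.filter fun j : Fin m => P j).card := by
  rw [Finset.card_filter, Finset.card_filter, Finset.sum_range]

/-- In a round without bad events, the number of queries is of the order of the probability of the
disagreement region times the number of examples. -/
lemma roundQueries_le {hstar : Classifier X} {q y : ℝ} {n r : ℕ} {ω : Draws X k}
    (hbad : ω ∉ BadRound erm D H d δ hstar q y n r)
    (hq : ∀ i, (D i).real {z | z.1 ∈ DIS (versionSpace passiveConstants erm D H d δ ω n)} ≤ q) :
    ((((Finset.range (mixSize passiveConstants k d (phaseErr (n + 1)) (phaseConf δ (n + 1)))).filter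
          fun j => ((phaseDraws ω (n + 1) r j).mix (mixIndex
            (phaseWeights passiveConstants erm D H d δ n r ω) (phaseDraws ω (n + 1) r j).u)).1 ∈
            DIS (versionSpace passiveConstants erm D H d δ ω n)).card +
        ∑ i : Fin k, ((Finset.range
          (testSize passiveConstants k (phaseErr (n + 1)) (phaseConf δ (n + 1)))).filter
          fun j => ((phaseDraws ω (n + 1) r j).test i).1 ∈
            DIS (versionSpace passiveConstants erm D H d δ ω n)).card : ℕ) : ℝ) ≤
      2 * mixSize passiveConstants k d (phaseErr (n + 1)) (phaseConf δ (n + 1)) * q + y +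
        (2 * k * testSize passiveConstants k (phaseErr (n + 1)) (phaseConf δ (n + 1)) * q + y) := by
  simp only [BadRound, mem_union, not_or] at hbad
  obtain ⟨-, -, -, h4, h5⟩ := hbad
  push_cast
  refine add_le_add ?_ ?_
  · by_contra hlt
    refine h4 ⟨hq, (not_le.1 hlt).le.trans (le_of_eq ?_)⟩
    rw [card_filter_range_eq]
    rfl
  · by_contra hlt
    refine h5 ⟨hq, (not_le.1 hlt).le.trans (le_of_eq ?_)⟩
    refine Finset.sum_congr rfl fun i _ => ?_
    rw [card_filter_range_eq]
    rfl

variable [∀ i, IsProbabilityMeasure (D i)]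

/-- The query bound in a run without bad events: `O(log (2 / ε))` phases of `O(Λ)` rounds with
`O(((d + k) θ + 1) Λ)` queries each, where `Λ` is the logarithm of `4 (d + k) / (ε δ)`. -/
lemma labelQueries_le (hε : 0 < ε) (hε1 : ε < 1) (hδ : 0 < δ) (hδ1 : δ < 1)
    {hstar : Classifier X} {ω : Draws X k}
    (hmem : ∀ n ≤ numPhases ε, hstar ∈ versionSpace passiveConstants erm D H d δ ω n)
    (hbad : ∀ n < numPhases ε, ∀ r < numRounds passiveConstants k,
      ω ∉ BadRound erm D H d δ hstar (disCoeffMax D H hstar ε * (4 * phaseErr n))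
        (2 * Real.log (1 / roundConf passiveConstants k (phaseConf δ (n + 1)))) n r) :
    (labelQueries passiveConstants erm D H d ε δ ω : ℝ) ≤
      40000000000 * ((d + k) * disCoeffMax D H hstar ε + 1) * Real.log (2 / ε) *
        Real.log (4 * (d + k) / (ε * δ)) ^ 2 := by
  have hk : 0 < k := Nat.pos_of_ne_zero (NeZero.ne k)
  have hk1 : (1 : ℝ) ≤ k := by exact_mod_cast hk
  have hd0 : (0 : ℝ) ≤ d := Nat.cast_nonneg d
  set θ := disCoeffMax D H hstar ε with hθ
  have hθ0 : 0 ≤ θ := disCoeffMax_nonneg D H hstar hε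
  set Λ := Real.log (4 * (d + k) / (ε * δ)) with hΛ
  have hdk : 0 ≤ (d + k) * θ := by positivity
  have hround : ∀ n < numPhases ε, ∀ r < numRounds passiveConstants k,
      ((((Finset.range (mixSize passiveConstants k d (phaseErr (n + 1))
          (phaseConf δ (n + 1)))).filter
          fun j => ((phaseDraws ω (n + 1) r j).mix (mixIndex
            (phaseWeights passiveConstants erm D H d δ n r ω) (phaseDraws ω (n + 1) r j).u)).1 ∈
            DIS (versionSpace passiveConstants erm D H d δ ω n)).card +
        ∑ i : Fin k, ((Finset.range
          (testSize passiveConstants k (phaseErr (n + 1)) (phaseConf δ (n + 1)))).filter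
          fun j => ((phaseDraws ω (n + 1) r j).test i).1 ∈
            DIS (versionSpace passiveConstants erm D H d δ ω n)).card : ℕ) : ℝ) ≤
      40000000 * ((d + k) * θ + 1) * Λ := by
    intro n hn r hr
    obtain ⟨hδ'0, hδ'1, hΛ1, hL, hlk, hl, -⟩ := parameter_bounds hk d hε hε1 hδ hδ1 hn
    have hζ0 := phaseErr_pos (n + 1)
    have hζ1 := phaseErr_le_one (n + 1)
    refine (roundQueries_le (hbad n hn r hr) fun i => measureReal_DIS_le D H hstar hε
      (le_four_mul_phaseErr hε hn) i
      (versionSpace_subset_disBall passiveConstants (hmem n hn.le) i)).trans ?_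
    rw [phaseErr_succ n]
    have hl0 : 0 ≤ Real.log (1 / roundConf passiveConstants k (phaseConf δ (n + 1))) :=
      Real.log_nonneg (by rw [le_div_iff₀ hδ'0]; linarith)
    have hlk0 : 0 ≤ Real.log (2 * k / roundConf passiveConstants k (phaseConf δ (n + 1))) :=
      Real.log_nonneg (by rw [le_div_iff₀ hδ'0]; linarith)
    have hL0 : 0 ≤ Real.log (2 / phaseErr (n + 1)) :=
      Real.log_nonneg (by rw [le_div_iff₀ hζ0]; linarith)
    have hm : phaseErr (n + 1) *
        mixSize passiveConstants k d (phaseErr (n + 1)) (phaseConf δ (n + 1)) ≤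
        100000 * (d * Real.log (2 / phaseErr (n + 1)) +
          Real.log (1 / roundConf passiveConstants k (phaseConf δ (n + 1)))) + 1 :=
      mul_ceil_div_le hζ0 hζ1 (mul_nonneg passiveConstants.size_pos.le
        (add_nonneg (mul_nonneg hd0 hL0) hl0))
    have hm' : phaseErr (n + 1) *
        testSize passiveConstants k (phaseErr (n + 1)) (phaseConf δ (n + 1)) ≤
        100000 * Real.log (2 * k / roundConf passiveConstants k (phaseConf δ (n + 1))) + 1 :=
      mul_ceil_div_le hζ0 hζ1 (mul_nonneg passiveConstants.size_pos.le hlk0)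
    set ζ := phaseErr (n + 1)
    set M : ℝ := (mixSize passiveConstants k d ζ (phaseConf δ (n + 1)) : ℝ)
    set T : ℝ := (testSize passiveConstants k ζ (phaseConf δ (n + 1)) : ℝ)
    have hM : ζ * M ≤ 1100001 * ((d + k) * Λ) := by
      have h1 : d * Real.log (2 / ζ) ≤ d * (2 * Λ) := by gcongr
      have h2 : Λ ≤ k * Λ := le_mul_of_one_le_left (by linarith) hk1
      have h3 : 0 ≤ d * Λ := by positivity
      linarith
    have hT : k * (ζ * T) ≤ 900001 * ((d + k) * Λ) := by
      have h1 : k * (ζ * T) ≤ k * (900001 * Λ) :=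
        mul_le_mul_of_nonneg_left (by linarith) (by linarith)
      have h3 : 0 ≤ d * Λ := by positivity
      linarith
    have hM' := mul_le_mul_of_nonneg_left hM hθ0
    have hT' := mul_le_mul_of_nonneg_left hT hθ0
    have hpos : 0 ≤ θ * ((d + k) * Λ) := by positivity
    linarith
  have hphase : ∀ n < numPhases ε,
      (passiveQueries passiveConstants erm d (versionSpace passiveConstants erm D H d δ ω n)
        (phaseErr (n + 1)) (phaseConf δ (n + 1)) (phaseDraws ω (n + 1)) : ℝ) ≤
      200 * Λ * (40000000 * ((d + k) * θ + 1) * Λ) := by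
    intro n hn
    obtain ⟨-, -, hΛ1, -, -, -, ht⟩ := parameter_bounds hk d hε hε1 hδ hδ1 hn
    have h1 : (passiveQueries passiveConstants erm d
        (versionSpace passiveConstants erm D H d δ ω n) (phaseErr (n + 1)) (phaseConf δ (n + 1))
        (phaseDraws ω (n + 1)) : ℝ) ≤
        ∑ _r ∈ Finset.range (numRounds passiveConstants k), 40000000 * ((d + k) * θ + 1) * Λ := by
      rw [passiveQueries, Nat.cast_sum]
      exact Finset.sum_le_sum fun r hr => hround n hn r (Finset.mem_range.1 hr)
    rw [Finset.sum_const, Finset.card_range, nsmul_eq_mul] at h1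
    refine h1.trans ?_
    gcongr
  have hsum : (labelQueries passiveConstants erm D H d ε δ ω : ℝ) ≤
      ∑ _n ∈ Finset.range (numPhases ε), 200 * Λ * (40000000 * ((d + k) * θ + 1) * Λ) := by
    rw [labelQueries, Nat.cast_sum]
    exact Finset.sum_le_sum fun n hn => hphase n (Finset.mem_range.1 hn)
  rw [Finset.sum_const, Finset.card_range, nsmul_eq_mul] at hsum
  calc _ ≤ (numPhases ε : ℝ) * (200 * Λ * (40000000 * ((d + k) * θ + 1) * Λ)) := hsum
    _ ≤ 5 * Real.log (2 / ε) * (200 * Λ * (40000000 * ((d + k) * θ + 1) * Λ)) := by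
      refine mul_le_mul_of_nonneg_right (numPhases_le hε hε1) ?_
      have : 200 * Λ * (40000000 * ((d + k) * θ + 1) * Λ) =
        200 * (40000000 * ((d + k) * θ + 1)) * Λ ^ 2 := by ring
      rw [this]
      positivity
    _ = _ := by ring

end Queries

end ActiveMDL

theorem mainTheorem1 :
    ∃ (κ : ActiveMDL.PassiveConstants) (C : ℝ), 0 < C ∧
      ∀ {X : Type*} [MeasurableSpace X] (k : ℕ) [NeZero k]
        (D : Fin k → Measure (ActiveMDL.LExample X)) [∀ i, IsProbabilityMeasure (D i)]
        (H : Set (ActiveMDL.Classifier X)) (_ : ∀ h ∈ H, Measurable h)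
        (d : ℕ) (_ : ActiveMDL.vcDim H = d)
        (hstar : ActiveMDL.Classifier X) (_ : hstar ∈ H)
        (_ : ∀ h ∈ H, ActiveMDL.mdErr D hstar ≤ ActiveMDL.mdErr D h)
        (ε δ : ℝ) (_ : 0 < ε) (_ : ε < 1) (_ : 0 < δ) (_ : δ < 1)
        (_ : 100 * ActiveMDL.mdErr D hstar ≤ ε)
        (erm : ActiveMDL.Rule X) (_ : ActiveMDL.IsERM erm)
        (_ : ActiveMDL.MeasurableRun κ erm D H d ε δ),
        ActiveMDL.drawLaw D {ω | ¬ (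
            (ActiveMDL.versionSpace κ erm D H d δ ω (ActiveMDL.numPhases ε)).Nonempty ∧
            (∀ h ∈ ActiveMDL.versionSpace κ erm D H d δ ω (ActiveMDL.numPhases ε),
              ActiveMDL.mdErr D h ≤ ActiveMDL.mdErr D hstar + ε) ∧
            (ActiveMDL.labelQueries κ erm D H d ε δ ω : ℝ) ≤
              C * ((d + k) * ActiveMDL.disCoeffMax D H hstar ε + 1) * Real.log (2 / ε) *
                Real.log (4 * (d + k) / (ε * δ)) ^ 2)}
          ≤ ENNReal.ofReal δ := by
  refine ⟨ActiveMDL.passiveConstants, 40000000000, by norm_num, ?_⟩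
  intro X _ k _ D _ H hHm d hd hstar hH _ ε δ hε hε1 hδ hδ1 hν erm herm hrun
  obtain ⟨x⟩ : Nonempty X := by
    obtain ⟨z⟩ := (D 0).nonempty_of_neZero
    exact ⟨z.1⟩
  have hopt : ∀ n < ActiveMDL.numPhases ε, ∀ i,
      ActiveMDL.err (D i) hstar ≤ 0.08 * ActiveMDL.phaseErr (n + 1) := by
    intro n hn i
    have h1 := ActiveMDL.err_le_mdErr D hstar i
    have h2 := ActiveMDL.le_four_mul_phaseErr hε hn
    rw [ActiveMDL.phaseErr_succ n] at h2
    linarith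
  have hθ := ActiveMDL.disCoeffMax_nonneg D H hstar hε
  refine le_trans (measure_mono ?_) (ActiveMDL.drawLaw_iUnion_badRound_le hrun herm hd x hε hε1 hδ
    hδ1 (hHm hstar hH)
    (q := fun n => ActiveMDL.disCoeffMax D H hstar ε * (4 * ActiveMDL.phaseErr n))
    (fun n => mul_nonneg hθ (by linarith [ActiveMDL.phaseErr_pos n])) hopt)
  intro ω hω
  by_contra hgood
  apply hω
  simp only [mem_iUnion, Finset.mem_range, not_exists] at hgood
  have hmem : ∀ n ≤ ActiveMDL.numPhases ε,
      hstar ∈ ActiveMDL.versionSpace ActiveMDL.passiveConstants erm D H d δ ω n := fun n hn =>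
    ActiveMDL.mem_versionSpace hrun herm hH hopt
      (fun n hn r hr h => hgood n hn r hr (Or.inl h))
      (fun n hn r hr h => hgood n hn r hr (Or.inr (Or.inl h)))
      (fun n hn r hr i h => hgood n hn r hr (Or.inr (Or.inr (Or.inl (mem_iUnion.2 ⟨i, h⟩))))) hn
  refine ⟨⟨hstar, hmem _ le_rfl⟩, fun h hh => ciSup_le fun i => ?_,
    ActiveMDL.labelQueries_le hε hε1 hδ hδ1 hmem hgood⟩
  have h1 := ActiveMDL.err_le_err_add_rho (D i) h hstar
  rw [ActiveMDL.rho_comm] at h1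
  have h2 := (ActiveMDL.versionSpace_subset_disBall ActiveMDL.passiveConstants
    (hmem _ le_rfl) i hh).2
  have h3 := ActiveMDL.four_mul_phaseErr_numPhases_le hε
  have h4 := ActiveMDL.err_le_mdErr D hstar i
  linarith
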